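/- **Setting.** A QBF is a closed prenex formula $\mathcal Q.\,\phi$ with $\phi$ in CNF, no clause of $\phi$ being tautological and no variable being quantified twice; $\mathrm{ind}(x)$ is the position of the variable $x$ in the prefix. Consider QBFs of the form $$\mathcal F=\exists \vec p\,\mathcal Q\vec q\,\mathcal Q\vec r\,[A(\vec p,\vec q)\wedge B(\vec p,\vec r)],$$ where $\vec p,\vec q,\vec r$ are mutually disjoint, the CNF $A$ uses only variables from $\vec p,\vec q$, the CNF $B$ uses only variables from $\vec p,\vec r$, and the quantification of $\vec q$ and $\vec r$ is arbitrary. An *interpolation circuit* for $\mathcal F$ is a Boolean circuit $G$ with inputs among $\vec p$ such that for every assignment $\vec a$ to $\vec p$: if $G(\vec a)=0$ then $\mathcal Q\vec q.A(\vec a,\vec q)$ is false, and if $G(\vec a)=1$ then $\mathcal Q\vec r.B(\vec a,\vec r)$ is false. A *proof* of $\mathcal F$ in a calculus is a sequence of clauses (read as sets of literals) ending in the empty clause, each line carrying the rule application by which it is obtained: it is a leaf, together with the clause of the matrix it comes from, or it follows from earlier lines by a rule of the calculus. Its size is its number of clauses. A circuit is *monotone* if it contains no negation and no selector gate. A calculus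 $S$ has *monotone feasible interpolation* if there is a computable procedure that, given $\mathcal F$ and any $S$-proof $\pi$ of $\mathcal F$, outputs an interpolation circuit for $\mathcal F$ over the basis $\{0,1,\neg,\wedge,\vee\}$, of size polynomial in the size of $\pi$, which is monotone whenever $\vec p$ occurs only positively in $A$. **Calculi on clauses with literals $x,\neg x,x^*$.** Leaves are the clauses of the matrix. The rules are: * $\forall$-Red: from $D\vee u$ infer $D$, where $u$ is a universal literal that is not merged (not of the form $z^*$), and $\mathrm{ind}(u)\ge\mathrm{ind}(l)$ for all existential $l\in D$; $\forall$-Red$^*$: the same with $u^*$ in place of $u$. * Short resolution: from $C_1\vee x$ and $C_2\vee\neg x$ infer $C_1\vee C_2$, provided there is no $z\in C_1$ with $\neg z\in C_2$. * Long-distance resolution: from $C_1\vee U_1\vee x$ and $C_2\vee U_2\vee\neg x$ infer $C_1\vee C_2\vee\{u^*: u\in\mathrm{var}(U_1)\}$, provided that $l_1\in C_1$, $l_2\in C_2$ with the same variable satisfy $l_1=l_2$ and are not merged; $U_1,U_2$ consist of universal literals of index greater than $\mathrm{ind}(x)$ with $\mathrm{var}(U_1)=\mathrm{var}(U_2)$;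 and $w_1\in U_1$, $w_2\in U_2$ with the same variable $u$ satisfy $w_1=\neg w_2$, $w_1=u^*$ or $w_2=u^*$. (In each rule the displayed parts of a premise are disjoint.) *Q-Res*: short resolution on existential $x$, $\forall$-Red. *Tree-Q-Res*: Q-Res proofs in which each line is used at most once as a premise. *LD-Q-Res*: long-distance resolution on existential $x$, $\forall$-Red, $\forall$-Red$^*$. *QU-Res*: short resolution on existential or universal $x$, $\forall$-Red. *LQU$^+$-Res*: long-distance resolution on existential or universal $x$, $\forall$-Red, $\forall$-Red$^*$. **Calculi on annotated clauses.** Literals are $l^\sigma$ with $l$ existential and $\sigma$ a partial map from the universal variables to $\{0,1,*\}$. Write $l^{[\sigma]}$ for $l$ annotated by the restriction of $\sigma$ to variables $u$ with $\mathrm{ind}(u)<\mathrm{ind}(l)$; write $\sigma\circ\tau$ for $\sigma$ extended by $\tau$ outside the domain of $\sigma$; and let $\mathrm{inst}(\tau,C)=\{l^{[\sigma\circ\tau]}: l^\sigma\in C\}$. * *$\forall$Exp+Res*: the leaves are $\{l^{[\tau]}: l\in C\text{ existential}\}$, where $C$ is a clause of the matrix and $\tau$ is a $0/1$ assignment to all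 universal variables that falsifies every universal literal of $C$. The only rule is: from $x^\tau\vee C_1$ and $\neg x^\tau\vee C_2$ infer $C_1\cup C_2$. * *IR-calc*: the leaves are as above, but $\tau$ assigns only the universal variables of $C$, falsifying its universal literals. The rules are the same resolution rule, and instantiation: from $C$ infer $\mathrm{inst}(\tau,C)$, for a partial $0/1$ assignment $\tau$ to universal variables. * *IRM-calc*: leaves and instantiation as in IR-calc. Resolution: from $x^{\tau\cup\xi}\vee C_1$ and $\neg x^{\tau\cup\sigma}\vee C_2$ infer $\mathrm{inst}(\sigma,C_1)\cup\mathrm{inst}(\xi,C_2)$, where $\tau,\xi,\sigma$ have mutually disjoint domains and $\tau$ has values in $\{0,1\}$. Merging: from $C\vee b^\mu\vee b^\sigma$ with $\mathrm{dom}\,\mu=\mathrm{dom}\,\sigma$ infer $C\vee b^\xi$, where $\xi(u)=\mu(u)$ if $\mu(u)=\sigma(u)$, and $\xi(u)=*$ otherwise on the common domain. **Theorem.** LQU$^+$-Res and IRM-calc have monotone feasible interpolation. Moreover, for each of these two systems there is a computable procedure that, given $\mathcal F$ and any proof $\pi$ of $\mathcal F$, outputs an interpolation circuit for $\mathcal F$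 built from constants, $\wedge$, $\vee$ and selector gates $\mathrm{sel}(x,g_v,g_w)$ with $x\in\vec p$ (equal to $g_v$ if $x=0$ and to $g_w$ if $x=1$), of size polynomial in the size of $\pi$, such that whenever $\vec p$ occurs only positively in $A$, replacing each selector gate $\mathrm{sel}(x,g_v,g_w)$ by $(x\vee g_v)\wedge g_w$ gives a monotone interpolation circuit for $\mathcal F$. Both statements also hold for Tree-Q-Res, Q-Res, LD-Q-Res, QU-Res, $\forall$Exp+Res and IR-calc. -/

import Mathlib

namespace QBFInterpolation

/-! ## Quantified Boolean formulas -/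

/-- The two quantifiers. -/
inductive Quant
  | ex
  | all

/-- An ordinary literal over the variables `ℕ`: `(x, true)` is `x` and `(x, false)` is `¬ x`. -/
abbrev Lit := ℕ × Bool

/-- A conjunction of clauses; a clause is a list of literals, read as a disjunction. -/
abbrev CNF := List (List Lit)

/-- A quantifier prefix, outermost quantifier first. -/
abbrev Prefix := List (Quant × ℕ)

def IsEx (Q : Prefix) (x : ℕ) : Prop := (Quant.ex, x) ∈ Q

def IsAll (Q : Prefix) (x : ℕ) : Prop := (Quant.all, x) ∈ Q

/-- The index of a variable: its position in the prefix. -/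
def idx (Q : Prefix) (x : ℕ) : ℕ := (Q.map Prod.snd).idxOf x

/-- The assignment `α` satisfies every clause of `φ`. -/
def CNF.Sat (φ : CNF) (α : ℕ → Bool) : Prop := ∀ C ∈ φ, ∃ l ∈ C, α l.1 = l.2

/-- `QTrue Q φ α`: the formula `Q. φ` is true when its free variables are read off from `α`. -/
def QTrue : Prefix → CNF → (ℕ → Bool) → Prop
  | [], φ, α => CNF.Sat φ α
  | (Quant.ex, x) :: Q, φ, α => ∃ b : Bool, QTrue Q φ (Function.update α x b)
  | (Quant.all, x) :: Q, φ, α => ∀ b : Bool, QTrue Q φ (Function.update α x b)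

/-- The data of a formula `∃ p 𝒬 q 𝒬 r. [A(p, q) ∧ B(p, r)]`. -/
structure Instance where
  p : List ℕ
  q : Prefix
  r : Prefix
  A : CNF
  B : CNF

namespace Instance

/-- The prefix `∃ p 𝒬 q 𝒬 r`. -/
def pre (F : Instance) : Prefix := F.p.map (fun x => (Quant.ex, x)) ++ F.q ++ F.r

/-- The matrix `A ∧ B`. -/
def matrix (F : Instance) : CNF := F.A ++ F.B

/-- No variable is quantified twice (so `p`, `q`, `r` are mutually disjoint), `A` is over `p, q`,
`B` is over `p, r`, and no clause of the matrix is tautological. -/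
structure WellFormed (F : Instance) : Prop where
  nodup : (F.pre.map Prod.snd).Nodup
  varsA : ∀ C ∈ F.A, ∀ l ∈ C, l.1 ∈ F.p ∨ l.1 ∈ F.q.map Prod.snd
  varsB : ∀ C ∈ F.B, ∀ l ∈ C, l.1 ∈ F.p ∨ l.1 ∈ F.r.map Prod.snd
  nontaut : ∀ C ∈ F.matrix, ∀ x : ℕ, ¬ ((x, true) ∈ C ∧ (x, false) ∈ C)

/-- The variables `p` occur only positively in `A`. -/
def PositiveInA (F : Instance) : Prop := ∀ C ∈ F.A, ∀ x ∈ F.p, (x, false) ∉ C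

end Instance

/-! ## Proofs as labelled directed acyclic graphs -/

/-- How a line of a proof is obtained: it is a leaf, labelled by the `k`-th clause of the matrix; or
it is obtained from line `i` by a rule with one premise; or from lines `i`, `j` by a resolution rule
with pivot variable `x`, line `i` holding the positive and line `j` the negative pivot literal. -/
inductive Source
  | leaf (k : ℕ)
  | unary (i : ℕ)
  | res (i j x : ℕ)

/-- The premises of a line. -/
def Source.premises : Source → List ℕ
  | leaf _ => []
  | unary i => [i]
  | res i j _ => [i, j]

/-- A proof: the sequence of its lines, each one a clause (a list of literals of the calculus)
together with its origin. Its size is the number of lines. -/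
abbrev ProofGraph (Λ : Type) := List (List Λ × Source)

/-- A resolution calculus with literals `Λ`: its leaf rule (prefix, clause of the matrix, derived
line), its one-premise rules (prefix, premise, conclusion), its resolution rules (prefix, pivot
variable, positive premise, negative premise, conclusion), and a condition on the shape of the
proof. -/
structure Calculus (Λ : Type) where
  leafRule : Prefix → List Lit → List Λ → Prop
  unaryRule : Prefix → List Λ → List Λ → Prop
  resRule : Prefix → ℕ → List Λ → List Λ → List Λ → Prop
  shape : ProofGraph Λ → Prop

/-- Line `i` of `π` carries the clause `C`. -/
def ProofGraph.HasClause {Λ : Type} (π : ProofGraph Λ) (i : ℕ) (C : List Λ) : Prop :=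
  ∃ s, π[i]? = some (C, s)

/-- The clause `C` at line `i` of `π` is correctly obtained in the way `s` claims. -/
def Calculus.StepOK {Λ : Type} (S : Calculus Λ) (Q : Prefix) (φ : CNF) (π : ProofGraph Λ)
    (i : ℕ) (C : List Λ) : Source → Prop
  | Source.leaf k => ∃ D, φ[k]? = some D ∧ S.leafRule Q D C
  | Source.unary j => j < i ∧ ∃ D, π.HasClause j D ∧ S.unaryRule Q D C
  | Source.res j k x => j < i ∧ k < i ∧
      ∃ D E, π.HasClause j D ∧ π.HasClause k E ∧ S.resRule Q x D E C

/-- `π` is an `S`-refutation of `Q. φ`: every line is correct and the last one is the empty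
clause. -/
def Calculus.Refutes {Λ : Type} (S : Calculus Λ) (Q : Prefix) (φ : CNF) (π : ProofGraph Λ) :
    Prop :=
  (∀ i C s, π[i]? = some (C, s) → S.StepOK Q φ π i C s) ∧
  (∃ s, π.getLast? = some ([], s)) ∧ S.shape π

/-- Every line is used at most once as a premise. -/
def TreeLike {Λ : Type} (π : ProofGraph Λ) : Prop :=
  (π.flatMap fun n => n.2.premises).Nodup

/-- Clauses are read as sets of literals. -/
def litSet {Λ : Type} (C : List Λ) : Set Λ := {l | l ∈ C}

/-! ## The CDCL-based calculi -/

/-- The three kinds of literals over a variable `x`: `x`, `¬ x`, and the merged literal `x*`. -/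
inductive Sign
  | pos
  | neg
  | star

def Sign.compl : Sign → Sign
  | pos => neg
  | neg => pos
  | star => star

/-- A literal of the CDCL-based calculi. -/
abbrev MLit := ℕ × Sign

def Lit.toMLit (l : Lit) : MLit := (l.1, if l.2 then Sign.pos else Sign.neg)

namespace CDCL

/-- A leaf is a clause of the matrix. -/
def Leaf (_Q : Prefix) (C : List Lit) (D : List MLit) : Prop :=
  litSet D = Lit.toMLit '' litSet C

/-- Universal reduction `∀-Red`, from `D ∨ u` infer `D`, where `u` is a universal literal that is
not merged, and `ind(u) ≥ ind(l)` for all existential `l ∈ D`. -/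
def URed (Q : Prefix) (C D : Set MLit) : Prop :=
  ∃ l ∈ C, l.2 ≠ Sign.star ∧ IsAll Q l.1 ∧ D = C \ {l} ∧
    ∀ k ∈ D, IsEx Q k.1 → idx Q k.1 ≤ idx Q l.1

/-- `∀-Red*`, the same for a merged literal `u*`. -/
def URedStar (Q : Prefix) (C D : Set MLit) : Prop :=
  ∃ l ∈ C, l.2 = Sign.star ∧ IsAll Q l.1 ∧ D = C \ {l} ∧
    ∀ k ∈ D, IsEx Q k.1 → idx Q k.1 ≤ idx Q l.1

/-- Short-distance resolution on `x`: from `C₁ ∨ x` and `C₂ ∨ ¬ x` infer `C₁ ∨ C₂`, provided there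
is no `z ∈ C₁` with `¬ z ∈ C₂`. -/
def SRes (x : ℕ) (C D E : Set MLit) : Prop :=
  ∃ C₁ C₂ : Set MLit,
    (x, Sign.pos) ∉ C₁ ∧ C = C₁ ∪ {(x, Sign.pos)} ∧
    (x, Sign.neg) ∉ C₂ ∧ D = C₂ ∪ {(x, Sign.neg)} ∧
    (∀ z ∈ C₁, (z.1, z.2.compl) ∉ C₂) ∧
    E = C₁ ∪ C₂

/-- Long-distance resolution on `x`: from `C₁ ∨ U₁ ∨ x` and `C₂ ∨ U₂ ∨ ¬ x` infer `C₁ ∨ C₂ ∨ U`. -/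
def LRes (Q : Prefix) (x : ℕ) (C D E : Set MLit) : Prop :=
  ∃ C₁ U₁ C₂ U₂ : Set MLit,
    Disjoint C₁ U₁ ∧ (x, Sign.pos) ∉ C₁ ∪ U₁ ∧ C = C₁ ∪ U₁ ∪ {(x, Sign.pos)} ∧
    Disjoint C₂ U₂ ∧ (x, Sign.neg) ∉ C₂ ∪ U₂ ∧ D = C₂ ∪ U₂ ∪ {(x, Sign.neg)} ∧
    (∀ l₁ ∈ C₁, ∀ l₂ ∈ C₂, l₁.1 = l₂.1 → l₁ = l₂ ∧ l₁.2 ≠ Sign.star) ∧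
    (∀ l ∈ U₁ ∪ U₂, IsAll Q l.1 ∧ idx Q x < idx Q l.1) ∧
    Prod.fst '' U₁ = Prod.fst '' U₂ ∧
    (∀ w₁ ∈ U₁, ∀ w₂ ∈ U₂, w₁.1 = w₂.1 →
      w₁.2 = w₂.2.compl ∨ w₁.2 = Sign.star ∨ w₂.2 = Sign.star) ∧
    E = C₁ ∪ C₂ ∪ (fun u => (u, Sign.star)) '' (Prod.fst '' U₁)

end CDCL

/-- Q-resolution: short-distance resolution on existential pivots, `∀-Red`. -/
def qRes : Calculus MLit where
  leafRule := CDCL.Leaf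
  unaryRule Q C D := CDCL.URed Q (litSet C) (litSet D)
  resRule Q x C D E := IsEx Q x ∧ CDCL.SRes x (litSet C) (litSet D) (litSet E)
  shape _ := True

/-- Tree-like Q-resolution. -/
def treeQRes : Calculus MLit where
  leafRule := qRes.leafRule
  unaryRule := qRes.unaryRule
  resRule := qRes.resRule
  shape := TreeLike

/-- Long-distance Q-resolution: long-distance resolution on existential pivots, `∀-Red`,
`∀-Red*`. -/
def ldQRes : Calculus MLit where
  leafRule := CDCL.Leaf
  unaryRule Q C D :=
    CDCL.URed Q (litSet C) (litSet D) ∨ CDCL.URedStar Q (litSet C) (litSet D)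
  resRule Q x C D E := IsEx Q x ∧ CDCL.LRes Q x (litSet C) (litSet D) (litSet E)
  shape _ := True

/-- QU-resolution: short-distance resolution on existential or universal pivots, `∀-Red`. -/
def quRes : Calculus MLit where
  leafRule := CDCL.Leaf
  unaryRule Q C D := CDCL.URed Q (litSet C) (litSet D)
  resRule Q x C D E :=
    (IsEx Q x ∨ IsAll Q x) ∧ CDCL.SRes x (litSet C) (litSet D) (litSet E)
  shape _ := True

/-- LQU⁺-resolution: long-distance resolution on existential or universal pivots, `∀-Red`,
`∀-Red*`. -/
def lquPlusRes : Calculus MLit where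
  leafRule := CDCL.Leaf
  unaryRule Q C D :=
    CDCL.URed Q (litSet C) (litSet D) ∨ CDCL.URedStar Q (litSet C) (litSet D)
  resRule Q x C D E :=
    (IsEx Q x ∨ IsAll Q x) ∧ CDCL.LRes Q x (litSet C) (litSet D) (litSet E)
  shape _ := True

/-! ## The expansion-based calculi -/

/-- The values `0`, `1`, `*` of annotations. -/
inductive AVal
  | zero
  | one
  | star

/-- A written annotated literal: a literal with a list of pairs `(u, c)`, standing for `c/u`. -/
abbrev ALit := Lit × List (ℕ × AVal)

/-- A partial map from variables to `{0, 1, *}`. -/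
abbrev Ann := ℕ → Option AVal

/-- The annotated literal that is meant, independent of the way the annotation is written. -/
def ALit.denote (l : ALit) : Lit × Ann := (l.1, fun u => l.2.lookup u)

/-- The annotated clause that is meant. -/
def denote (C : List ALit) : Set (Lit × Ann) := ALit.denote '' litSet C

namespace Ann

/-- The domain of a partial map. -/
def dom (σ : Ann) : Set ℕ := {u | σ u ≠ none}

/-- All values of `σ` lie in `{0, 1}`. -/
def Binary (σ : Ann) : Prop := ∀ u, σ u ≠ some AVal.star

/-- The completion of `τ` by `μ`: `τ` where it is defined, otherwise `μ`. If the domains are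
disjoint, this is the union `τ ∪ μ`. -/
def complete (τ μ : Ann) : Ann := fun u => (τ u).or (μ u)

open Classical in
/-- The annotation `[σ]` of a literal over `x`: the part of `σ` on universal variables of smaller
index. -/
noncomputable def permitted (Q : Prefix) (x : ℕ) (σ : Ann) : Ann :=
  fun u => if IsAll Q u ∧ idx Q u < idx Q x then σ u else none

open Classical in
/-- The merge of two annotations with the same domain: common values are kept, different ones become
`*`. -/
noncomputable def merge (μ σ : Ann) : Ann :=
  fun u => if μ u = σ u then μ u else some AVal.star

end Ann

namespace Expansion

/-- `inst(τ, C) = { l^[σ completed by τ] | l^σ ∈ C }`. -/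
noncomputable def inst (Q : Prefix) (τ : Ann) (C : Set (Lit × Ann)) : Set (Lit × Ann) :=
  (fun l => (l.1, Ann.permitted Q l.1.1 (Ann.complete l.2 τ))) '' C

/-- The assignment that falsifies the universal literals of `C` and is undefined elsewhere. -/
def falsifier (Q : Prefix) (C : List Lit) (τ : Ann) : Prop :=
  ∀ u, (τ u = some AVal.zero ↔ IsAll Q u ∧ (u, true) ∈ C) ∧
    (τ u = some AVal.one ↔ IsAll Q u ∧ (u, false) ∈ C) ∧ τ u ≠ some AVal.star

/-- `{ l^[τ] | l ∈ C existential }`. -/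
def annotate (Q : Prefix) (τ : Ann) (C : List Lit) : Set (Lit × Ann) :=
  (fun l : Lit => (l, Ann.permitted Q l.1 τ)) '' {l | l ∈ C ∧ IsEx Q l.1}

/-- The leaf rule of IR-calc and IRM-calc. -/
def Leaf (Q : Prefix) (C : List Lit) (D : List ALit) : Prop :=
  ∃ τ : Ann, falsifier Q C τ ∧ denote D = annotate Q τ C

/-- The leaf rule of `∀Exp+Res`: the annotation comes from a `0/1` assignment to all universal
variables that falsifies the universal literals of the clause. -/
def LeafComplete (Q : Prefix) (C : List Lit) (D : List ALit) : Prop :=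
  ∃ τ : Ann, τ.Binary ∧ τ.dom = {u | IsAll Q u} ∧
    (∀ u, IsAll Q u → (u, true) ∈ C → τ u = some AVal.zero) ∧
    (∀ u, IsAll Q u → (u, false) ∈ C → τ u = some AVal.one) ∧
    denote D = annotate Q τ C

/-- Instantiation by a `0/1` assignment to universal variables. -/
def Instantiation (Q : Prefix) (C D : Set (Lit × Ann)) : Prop :=
  ∃ τ : Ann, τ.Binary ∧ τ.dom ⊆ {u | IsAll Q u} ∧ D = inst Q τ C

/-- Merging: from `C ∨ b^μ ∨ b^σ` with `dom μ = dom σ` infer `C ∨ b^ξ`, where `ξ` is the merge of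
`μ` and `σ`. -/
def Merging (C D : Set (Lit × Ann)) : Prop :=
  ∃ (b : Lit) (μ σ : Ann), (b, μ) ∈ C ∧ (b, σ) ∈ C ∧ μ.dom = σ.dom ∧
    D = (C \ {(b, μ), (b, σ)}) ∪ {(b, Ann.merge μ σ)}

/-- Resolution of `x^τ ∨ C₁` and `¬ x^τ ∨ C₂` to `C₁ ∪ C₂`. -/
def Res (x : ℕ) (C D E : Set (Lit × Ann)) : Prop :=
  ∃ τ : Ann, ((x, true), τ) ∈ C ∧ ((x, false), τ) ∈ D ∧
    E = (C \ {((x, true), τ)}) ∪ (D \ {((x, false), τ)})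

/-- Resolution of `x^(τ ∪ ξ) ∨ C₁` and `¬ x^(τ ∪ σ) ∨ C₂` to `inst(σ, C₁) ∪ inst(ξ, C₂)`, where the
domains of `τ`, `ξ`, `σ` are mutually disjoint and `τ` has values in `{0, 1}`. -/
def MRes (Q : Prefix) (x : ℕ) (C D E : Set (Lit × Ann)) : Prop :=
  ∃ τ ξ σ : Ann, Disjoint τ.dom ξ.dom ∧ Disjoint τ.dom σ.dom ∧ Disjoint ξ.dom σ.dom ∧
    τ.Binary ∧
    ((x, true), Ann.complete τ ξ) ∈ C ∧ ((x, false), Ann.complete τ σ) ∈ D ∧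
    E = inst Q σ (C \ {((x, true), Ann.complete τ ξ)}) ∪
      inst Q ξ (D \ {((x, false), Ann.complete τ σ)})

end Expansion

/-- The calculus `∀Exp+Res`. -/
def forallExpRes : Calculus ALit where
  leafRule := Expansion.LeafComplete
  unaryRule _ _ _ := False
  resRule _ x C D E := Expansion.Res x (denote C) (denote D) (denote E)
  shape _ := True

/-- The calculus IR-calc. -/
def irCalc : Calculus ALit where
  leafRule := Expansion.Leaf
  unaryRule Q C D := Expansion.Instantiation Q (denote C) (denote D)
  resRule _ x C D E := Expansion.Res x (denote C) (denote D) (denote E)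
  shape _ := True

/-- The calculus IRM-calc. -/
def irmCalc : Calculus ALit where
  leafRule := Expansion.Leaf
  unaryRule Q C D :=
    Expansion.Instantiation Q (denote C) (denote D) ∨ Expansion.Merging (denote C) (denote D)
  resRule Q x C D E := Expansion.MRes Q x (denote C) (denote D) (denote E)
  shape _ := True

/-! ## Boolean circuits -/

/-- A gate. The arguments `i`, `j` are the positions of earlier gates, `x` is an input variable.
`sel x i j` has the value of gate `i` if `x = 0` and of gate `j` if `x = 1`;
`orAnd x i j` is the monotone connective `(x ∨ gᵢ) ∧ gⱼ`. -/
inductive Gate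
  | const (b : Bool)
  | input (x : ℕ)
  | not (i : ℕ)
  | and (i j : ℕ)
  | or (i j : ℕ)
  | sel (x i j : ℕ)
  | orAnd (x i j : ℕ)

namespace Gate

/-- The value of a gate, given the input and the list `vs` of the values of the earlier gates. -/
def eval (α : ℕ → Bool) (vs : List Bool) : Gate → Bool
  | const b => b
  | input x => α x
  | not i => !(vs.getD i false)
  | and i j => vs.getD i false && vs.getD j false
  | or i j => vs.getD i false || vs.getD j false
  | sel x i j => if α x then vs.getD j false else vs.getD i false
  | orAnd x i j => (α x || vs.getD i false) && vs.getD j false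

/-- The gates that feed a gate. -/
def args : Gate → List ℕ
  | const _ => []
  | input _ => []
  | not i => [i]
  | and i j => [i, j]
  | or i j => [i, j]
  | sel _ i j => [i, j]
  | orAnd _ i j => [i, j]

/-- The input variables that a gate reads. -/
def inputs : Gate → List ℕ
  | input x => [x]
  | sel x _ _ => [x]
  | orAnd x _ _ => [x]
  | _ => []

/-- The usual basis: constants, inputs, `¬`, `∧`, `∨`. -/
def IsStandard : Gate → Prop
  | sel _ _ _ => False
  | orAnd _ _ _ => False
  | _ => True

/-- The basis of selector circuits: constants, `∧`, `∨`, `sel`. -/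
def IsSelector : Gate → Prop
  | const _ => True
  | and _ _ => True
  | or _ _ => True
  | sel _ _ _ => True
  | _ => False

/-- The monotone gates: all but `¬` and `sel`. -/
def IsMonotone : Gate → Prop
  | not _ => False
  | sel _ _ _ => False
  | _ => True

/-- Replace a selector gate `sel(x, g, h)` by `(x ∨ g) ∧ h`; leave other gates unchanged. -/
def replaceSel : Gate → Gate
  | sel x i j => orAnd x i j
  | g => g

end Gate

/-- A circuit is the list of its gates in topological order; the last gate is the output. Its size
is the number of gates. -/
abbrev Circuit := List Gate

namespace Circuit

/-- The values of all gates. -/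
def values (α : ℕ → Bool) (G : Circuit) : List Bool :=
  G.foldl (fun vs g => vs ++ [g.eval α vs]) []

/-- The value of the output gate. -/
def eval (G : Circuit) (α : ℕ → Bool) : Bool := (values α G).getLastD false

/-- There is an output gate and every gate is fed by earlier gates only. -/
def WellFormed (G : Circuit) : Prop :=
  G ≠ [] ∧ ∀ i g, G[i]? = some g → ∀ j ∈ Gate.args g, j < i

def IsStandard (G : Circuit) : Prop := ∀ g ∈ G, Gate.IsStandard g

def IsSelector (G : Circuit) : Prop := ∀ g ∈ G, Gate.IsSelector g

def IsMonotone (G : Circuit) : Prop := ∀ g ∈ G, Gate.IsMonotone g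

/-- Replace every selector gate `sel(x, g, h)` by `(x ∨ g) ∧ h`. -/
def replaceSel (G : Circuit) : Circuit := G.map Gate.replaceSel

end Circuit

/-- `G` is an interpolation circuit for `F`: its inputs are among `p`, and for every assignment to
`p`, if `G` outputs `0` then `𝒬 q. A` is false, and if `G` outputs `1` then `𝒬 r. B` is false.
(The values of `α` outside `p` do not matter for a well-formed `F`.) -/
def IsInterpolationCircuit (F : Instance) (G : Circuit) : Prop :=
  G.WellFormed ∧ (∀ g ∈ G, ∀ x ∈ Gate.inputs g, x ∈ F.p) ∧
  ∀ α : ℕ → Bool,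
    (G.eval α = false → ¬ QTrue F.q F.A α) ∧ (G.eval α = true → ¬ QTrue F.r F.B α)

/-! ## Encodings, needed to speak of computable functions on formulas, proofs and circuits -/

def quantEquiv : Quant ≃ Bool where
  toFun
    | Quant.ex => false
    | Quant.all => true
  invFun
    | false => Quant.ex
    | true => Quant.all
  left_inv a := by cases a <;> rfl
  right_inv a := by cases a <;> rfl

instance : Primcodable Quant := Primcodable.ofEquiv Bool quantEquiv

def signEquiv : Sign ≃ Option Bool where
  toFun
    | Sign.pos => some true
    | Sign.neg => some false
    | Sign.star => none
  invFun
    | some true => Sign.pos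
    | some false => Sign.neg
    | none => Sign.star
  left_inv a := by cases a <;> rfl
  right_inv a := by rcases a with _ | _ | _ <;> rfl

instance : Primcodable Sign := Primcodable.ofEquiv (Option Bool) signEquiv

def avalEquiv : AVal ≃ Option Bool where
  toFun
    | AVal.zero => some false
    | AVal.one => some true
    | AVal.star => none
  invFun
    | some false => AVal.zero
    | some true => AVal.one
    | none => AVal.star
  left_inv a := by cases a <;> rfl
  right_inv a := by rcases a with _ | _ | _ <;> rfl

instance : Primcodable AVal := Primcodable.ofEquiv (Option Bool) avalEquiv

def instanceEquiv : Instance ≃ List ℕ × Prefix × Prefix × CNF × CNF where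
  toFun F := (F.p, F.q, F.r, F.A, F.B)
  invFun t := ⟨t.1, t.2.1, t.2.2.1, t.2.2.2.1, t.2.2.2.2⟩
  left_inv _ := rfl
  right_inv _ := rfl

instance : Primcodable Instance := Primcodable.ofEquiv _ instanceEquiv

def sourceEquiv : Source ≃ ℕ ⊕ ℕ ⊕ (ℕ × ℕ × ℕ) where
  toFun
    | Source.leaf k => Sum.inl k
    | Source.unary i => Sum.inr (Sum.inl i)
    | Source.res i j x => Sum.inr (Sum.inr (i, j, x))
  invFun
    | Sum.inl k => Source.leaf k
    | Sum.inr (Sum.inl i) => Source.unary i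
    | Sum.inr (Sum.inr t) => Source.res t.1 t.2.1 t.2.2
  left_inv a := by cases a <;> rfl
  right_inv a := by rcases a with _ | _ | _ <;> rfl

instance : Primcodable Source := Primcodable.ofEquiv _ sourceEquiv

def gateEquiv : Gate ≃
    Bool ⊕ ℕ ⊕ ℕ ⊕ (ℕ × ℕ) ⊕ (ℕ × ℕ) ⊕ (ℕ × ℕ × ℕ) ⊕ (ℕ × ℕ × ℕ) where
  toFun
    | Gate.const b => Sum.inl b
    | Gate.input x => Sum.inr (Sum.inl x)
    | Gate.not i => Sum.inr (Sum.inr (Sum.inl i))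
    | Gate.and i j => Sum.inr (Sum.inr (Sum.inr (Sum.inl (i, j))))
    | Gate.or i j => Sum.inr (Sum.inr (Sum.inr (Sum.inr (Sum.inl (i, j)))))
    | Gate.sel x i j => Sum.inr (Sum.inr (Sum.inr (Sum.inr (Sum.inr (Sum.inl (x, i, j))))))
    | Gate.orAnd x i j => Sum.inr (Sum.inr (Sum.inr (Sum.inr (Sum.inr (Sum.inr (x, i, j))))))
  invFun
    | Sum.inl b => Gate.const b
    | Sum.inr (Sum.inl x) => Gate.input x
    | Sum.inr (Sum.inr (Sum.inl i)) => Gate.not i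
    | Sum.inr (Sum.inr (Sum.inr (Sum.inl t))) => Gate.and t.1 t.2
    | Sum.inr (Sum.inr (Sum.inr (Sum.inr (Sum.inl t)))) => Gate.or t.1 t.2
    | Sum.inr (Sum.inr (Sum.inr (Sum.inr (Sum.inr (Sum.inl t))))) => Gate.sel t.1 t.2.1 t.2.2
    | Sum.inr (Sum.inr (Sum.inr (Sum.inr (Sum.inr (Sum.inr t))))) => Gate.orAnd t.1 t.2.1 t.2.2
  left_inv a := by cases a <;> rfl
  right_inv a := by rcases a with _ | _ | _ | _ | _ | _ | _ <;> rfl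

instance : Primcodable Gate := Primcodable.ofEquiv _ gateEquiv

/-! ## Monotone feasible interpolation -/

/-- `S` has monotone feasible interpolation: some effective procedure turns every `S`-refutation `π`
of a formula `F = ∃ p 𝒬 q 𝒬 r. [A(p, q) ∧ B(p, r)]` into an interpolation circuit for `F`, over the
usual basis and of size polynomial in the size of `π`, and this circuit is monotone whenever `p`
occurs only positively in `A`. -/
def HasMonotoneFeasibleInterpolation {Λ : Type} [Primcodable Λ] (S : Calculus Λ) : Prop :=
  ∃ extract : Instance × ProofGraph Λ → Circuit, Computable extract ∧
  ∃ P : Polynomial ℕ, ∀ (F : Instance) (π : ProofGraph Λ), F.WellFormed →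
    S.Refutes F.pre F.matrix π →
      IsInterpolationCircuit F (extract (F, π)) ∧
      (extract (F, π)).IsStandard ∧
      (extract (F, π)).length ≤ P.eval π.length ∧
      (F.PositiveInA → (extract (F, π)).IsMonotone)

/-- Some effective procedure turns every `S`-refutation `π` of a formula
`F = ∃ p 𝒬 q 𝒬 r. [A(p, q) ∧ B(p, r)]` into an interpolation circuit for `F`, built from constants,
`∧`, `∨` and selector gates and of size polynomial in the size of `π`, such that whenever `p` occurs
only positively in `A`, replacing every selector gate `sel(x, g, h)` by `(x ∨ g) ∧ h` gives a
monotone interpolation circuit for `F`. -/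
def MonotoneBySelectorReplacement {Λ : Type} [Primcodable Λ] (S : Calculus Λ) : Prop :=
  ∃ extract : Instance × ProofGraph Λ → Circuit, Computable extract ∧
  ∃ P : Polynomial ℕ, ∀ (F : Instance) (π : ProofGraph Λ), F.WellFormed →
    S.Refutes F.pre F.matrix π →
      IsInterpolationCircuit F (extract (F, π)) ∧
      (extract (F, π)).IsSelector ∧
      (extract (F, π)).length ≤ P.eval π.length ∧
      (F.PositiveInA →
        IsInterpolationCircuit F (extract (F, π)).replaceSel ∧
        (extract (F, π)).replaceSel.IsMonotone)

end QBFInterpolation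

/-!
Fix an assignment to the variables `p`. Going down the proof, every line receives a bit naming a
side, `A` (`0`) or `B` (`1`), such that the line is a sound consequence of that side's matrix alone
once its literals over `p` are false. A leaf takes the side of its clause, and a line with one
premise copies the bit of its premise. A resolution step on a variable of `p` copies the bit of the
premise whose pivot literal is false, which is a selector gate. A step on a variable of `q` takes
the disjunction of the two bits, a step on a variable of `r` their conjunction: either both premises
lie on the chosen side, or the pivot does not occur there and the premise on that side suffices. The
bit of the empty clause names a false side. If `p` is positive in `A`, then negative literals over
`p` do not matter on the side `A`, so that `(x ∨ g) ∧ h` serves as well as the selector.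

Soundness on one side is semantic: a clause is entailed if the universal player wins the game on the
side's prefix and matrix against an existential player who has to keep the clause falsified. A
merged literal `u*` stands for a move of the universal player that may depend on the play so far,
and annotations are constraints on these moves. The weaker calculi are special cases.
-/

namespace QBFInterpolation

/-! ### Blocks of a prefix and sides of an instance -/

section Block

variable {P Q : Prefix} {a : Quant × ℕ} {x : ℕ}

theorem IsEx.mem (h : IsEx Q x) : x ∈ Q.map Prod.snd := List.mem_map_of_mem h

theorem IsEx.not_isAll (hP : (P.map Prod.snd).Nodup) (he : IsEx P x) : ¬ IsAll P x := fun ha =>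
  Quant.noConfusion (congrArg Prod.fst (List.inj_on_of_nodup_map hP he ha rfl))

theorem pairwise_idx_lt (hP : (P.map Prod.snd).Nodup) :
    P.Pairwise fun a b => idx P a.2 < idx P b.2 := by
  refine List.pairwise_iff_getElem.2 fun i j hi hj hij => ?_
  have idx_getElem (k : ℕ) (hk : k < P.length) : idx P (P[k]).2 = k := by
    have := hP.idxOf_getElem k (by rwa [List.length_map])
    rwa [List.getElem_map] at this
  rwa [idx_getElem i hi, idx_getElem j hj]

/-- `Q` is a part of the prefix `P`, which quantifies no variable twice. -/
structure IsBlock (P Q : Prefix) : Prop where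
  nodup : (P.map Prod.snd).Nodup
  sublist : Q.Sublist P

namespace IsBlock

theorem tail (h : IsBlock P (a :: Q)) : IsBlock P Q :=
  ⟨h.nodup, (List.sublist_cons_self _ _).trans h.sublist⟩

theorem idx_lt (h : IsBlock P (a :: Q)) (hx : x ∈ Q.map Prod.snd) : idx P a.2 < idx P x := by
  obtain ⟨b, hb, rfl⟩ := List.mem_map.1 hx
  exact (List.pairwise_cons.1 ((pairwise_idx_lt h.nodup).sublist h.sublist)).1 b hb

theorem notMem_tail (h : IsBlock P (a :: Q)) : a.2 ∉ Q.map Prod.snd :=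
  fun hx => lt_irrefl _ (h.idx_lt hx)

theorem isEx (h : IsBlock P Q) (hx : IsEx Q x) : IsEx P x := h.sublist.subset hx

theorem isAll (h : IsBlock P Q) (hx : IsAll Q x) : IsAll P x := h.sublist.subset hx

end IsBlock

end Block

namespace Instance

variable {F : Instance} {s : Bool} {x : ℕ}

/-- The quantifier block that belongs to `A` (`false`) or to `B` (`true`). -/
def sidePrefix (F : Instance) (s : Bool) : Prefix := cond s F.r F.q

/-- The part `A` (`false`) or `B` (`true`) of the matrix. -/
def sideCNF (F : Instance) (s : Bool) : CNF := cond s F.B F.A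

theorem isEx_of_mem_p (hx : x ∈ F.p) : IsEx F.pre x :=
  List.mem_append_left _ (List.mem_append_left _ (List.mem_map_of_mem hx))

namespace WellFormed

theorem isBlock (hF : F.WellFormed) (s : Bool) : IsBlock F.pre (F.sidePrefix s) := by
  refine ⟨hF.nodup, ?_⟩
  cases s
  · exact (List.sublist_append_right _ _).trans (List.sublist_append_left _ _)
  · exact List.sublist_append_right _ _

theorem not_isAll_of_mem_p (hF : F.WellFormed) (hx : x ∈ F.p) : ¬ IsAll F.pre x :=
  (isEx_of_mem_p hx).not_isAll hF.nodup

theorem notMem_side (hF : F.WellFormed) (hx : x ∈ F.p) (s : Bool) :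
    x ∉ (F.sidePrefix s).map Prod.snd := by
  have h := hF.nodup
  simp only [pre, List.map_append, List.map_map, List.append_assoc] at h
  have hdisj := (List.nodup_append'.1 h).2.2 (List.mem_map.2 ⟨x, hx, rfl⟩)
  cases s
  · exact fun hs => hdisj (List.mem_append_left _ hs)
  · exact fun hs => hdisj (List.mem_append_right _ hs)

theorem notMem_r (hF : F.WellFormed) (hx : x ∈ F.q.map Prod.snd) : x ∉ F.r.map Prod.snd := by
  have h := hF.nodup
  simp only [pre, List.map_append, List.append_assoc] at h
  exact (List.nodup_append'.1 (List.nodup_append'.1 h).2.1).2.2 hx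

theorem mem_p_or_mem_side (hF : F.WellFormed) {K : List Lit} (hK : K ∈ F.sideCNF s) {l : Lit}
    (hl : l ∈ K) : l.1 ∈ F.p ∨ l.1 ∈ (F.sidePrefix s).map Prod.snd := by
  cases s
  · exact hF.varsA K hK l hl
  · exact hF.varsB K hK l hl

end WellFormed

theorem mem_sideCNF_of_getElem? {k : ℕ} {K : List Lit} (hK : F.matrix[k]? = some K) :
    K ∈ F.sideCNF (decide (F.A.length ≤ k)) := by
  by_cases hk : F.A.length ≤ k
  · rw [matrix, List.getElem?_append_right hk] at hK
    exact (decide_eq_true hk).symm ▸ List.mem_of_getElem? hK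
  · rw [matrix, List.getElem?_append_left (not_le.1 hk)] at hK
    exact (decide_eq_false hk).symm ▸ List.mem_of_getElem? hK

end Instance

/-! ### Interpolation along a proof -/

/-- A reading of the lines of `S`-proofs of `F`: `lits C` are the literals that the line `C`
contains, of which only those over `p` matter, and `Holds s α C` says that, under the assignment `α`
to `p`, the rest of `C` is a sound consequence of `A` (`s = false`) or `B` (`s = true`) alone. Here
and below, the premises of a resolution are indexed by the sign of their pivot literal. -/
structure SideSemantics {Λ : Type} (S : Calculus Λ) (F : Instance) where
  lits : List Λ → Set Lit
  Holds : Bool → (ℕ → Bool) → List Λ → Prop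
  leaf_lits : ∀ {K C}, S.leafRule F.pre K C → ∀ l ∈ K, l.1 ∈ F.p → l ∈ lits C
  leaf : ∀ {s α K C}, K ∈ F.sideCNF s → S.leafRule F.pre K C →
    (∀ l ∈ K, l.1 ∈ F.p → α l.1 ≠ l.2) → Holds s α C
  unary_lits : ∀ {C D}, S.unaryRule F.pre C D → ∀ l ∈ lits C, l.1 ∈ F.p → l ∈ lits D
  unary : ∀ {s α C D}, S.unaryRule F.pre C D → Holds s α C → Holds s α D
  res_lits : ∀ {x} {P : Bool → List Λ} {E}, S.resRule F.pre x (P true) (P false) E →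
    ∀ b, ∀ l ∈ lits (P b), l.1 ∈ F.p → l ≠ (x, b) → l ∈ lits E
  res_discard : ∀ {s α x} {P : Bool → List Λ} {E}, S.resRule F.pre x (P true) (P false) E →
    x ∉ (F.sidePrefix s).map Prod.snd → ∀ b, Holds s α (P b) → Holds s α E
  res : ∀ {s α x} {P : Bool → List Λ} {E}, S.resRule F.pre x (P true) (P false) E →
    (∀ b, Holds s α (P b)) → Holds s α E
  lits_nil : lits [] = ∅
  not_qTrue : ∀ {s α}, Holds s α [] → ¬ QTrue (F.sidePrefix s) (F.sideCNF s) α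

/-- The value at a line of the interpolating circuit in terms of the values `val` at its premises:
a selector at pivots in `p` (its monotone replacement if `mono`), a disjunction at pivots in `q`,
and a conjunction at pivots in `r`. -/
def lineValue (F : Instance) (mono : Bool) (α val : ℕ → Bool) : Source → Bool
  | Source.leaf k => decide (F.A.length ≤ k)
  | Source.unary j => val j
  | Source.res j k x =>
      if x ∈ F.p then
        if mono then (α x || val j) && val k else if α x then val k else val j
      else if x ∈ F.q.map Prod.snd then val j || val k
      else val j && val k

/-- In the monotone circuit, the negative literals over `p` of a line on the side of `A` do not
matter. `Relevant mono s b` says that literals of sign `b` do matter on the side `s`. -/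
def Relevant (mono s b : Bool) : Prop := b = true ∨ mono = false ∨ s = true

/-- All relevant literals over `p` in `L` are false under `α`. -/
def Falsified (F : Instance) (mono s : Bool) (α : ℕ → Bool) (L : Set Lit) : Prop :=
  ∀ l ∈ L, l.1 ∈ F.p → Relevant mono s l.2 → α l.1 ≠ l.2

theorem lineValue_res_of_mem_p {F : Instance} {j k x : ℕ} (hx : x ∈ F.p) (mono : Bool)
    (α val : ℕ → Bool) : ∃ b : Bool, val (cond b j k) = lineValue F mono α val (.res j k x) ∧
      (Relevant mono (lineValue F mono α val (.res j k x)) b → α x ≠ b) := by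
  simp only [lineValue, if_pos hx, Relevant]
  cases mono <;> cases α x <;> cases hj : val j <;> cases hk : val k <;> simp [hj, hk]

/-- Resolution on a variable outside `p`: a single premise on a side that does not quantify the
pivot suffices, and otherwise both premises lie on the same side. -/
theorem lineValue_res_of_notMem_p {F : Instance} (hF : F.WellFormed) {j k x : ℕ} (hx : x ∉ F.p)
    (mono : Bool) (α val : ℕ → Bool) :
    (∃ b : Bool, val (cond b j k) = lineValue F mono α val (.res j k x) ∧
      x ∉ (F.sidePrefix (lineValue F mono α val (.res j k x))).map Prod.snd) ∨
    ∀ b : Bool, val (cond b j k) = lineValue F mono α val (.res j k x) := by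
  by_cases hq : x ∈ F.q.map Prod.snd
  · have hr : x ∉ (F.sidePrefix true).map Prod.snd := hF.notMem_r hq
    simp only [lineValue, if_neg hx, if_pos hq]
    cases hj : val j <;> cases hk : val k <;> simp [hj, hk, hr]
  · have hq' : x ∉ (F.sidePrefix false).map Prod.snd := hq
    simp only [lineValue, if_neg hx, if_neg hq]
    cases hj : val j <;> cases hk : val k <;> simp [hj, hk, hq']

namespace SideSemantics

variable {Λ : Type} {S : Calculus Λ} {F : Instance} {mono : Bool} {α val : ℕ → Bool}

theorem holds_leaf (R : SideSemantics S F) (hmono : mono = true → F.PositiveInA) {s : Bool}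
    {K : List Lit} {C : List Λ} (hK : K ∈ F.sideCNF s) (h : S.leafRule F.pre K C)
    (hC : Falsified F mono s α (R.lits C)) : R.Holds s α C := by
  refine R.leaf hK h fun l hl hlp => hC l (R.leaf_lits h l hl hlp) hlp ?_
  by_contra hrel
  simp only [Relevant, not_or, Bool.not_eq_true, Bool.not_eq_false] at hrel
  obtain ⟨hl2, hm, rfl⟩ := hrel
  exact hmono hm K hK l.1 hlp (hl2 ▸ hl)

theorem holds_res (R : SideSemantics S F) (hF : F.WellFormed) {j k x : ℕ} {P : Bool → List Λ}
    {E : List Λ} (h : S.resRule F.pre x (P true) (P false) E)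
    (hP : ∀ b : Bool, Falsified F mono (val (cond b j k)) α (R.lits (P b)) →
      R.Holds (val (cond b j k)) α (P b))
    (hE : Falsified F mono (lineValue F mono α val (.res j k x)) α (R.lits E)) :
    R.Holds (lineValue F mono α val (.res j k x)) α E := by
  have holds_premise (b : Bool) (hb : val (cond b j k) = lineValue F mono α val (.res j k x))
      (hx : x ∈ F.p → Relevant mono (lineValue F mono α val (.res j k x)) b → α x ≠ b) :
      R.Holds (lineValue F mono α val (.res j k x)) α (P b) := by
    rw [← hb] at hE hx ⊢
    refine hP b fun l hl hlp => ?_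
    by_cases hlx : l = (x, b)
    · subst hlx
      exact hx hlp
    · exact hE l (R.res_lits h b l hl hlp hlx) hlp
  by_cases hxp : x ∈ F.p
  · obtain ⟨b, hb, hx⟩ := lineValue_res_of_mem_p (j := j) (k := k) hxp mono α val
    exact R.res_discard h (hF.notMem_side hxp _) b (holds_premise b hb fun _ => hx)
  · obtain ⟨b, hb, hx⟩ | hb := lineValue_res_of_notMem_p (j := j) (k := k) hF hxp mono α val
    · exact R.res_discard h hx b (holds_premise b hb fun hp => absurd hp hxp)
    · exact R.res h fun b => holds_premise b (hb b) fun hp => absurd hp hxp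

theorem holds (R : SideSemantics S F) (hF : F.WellFormed) (hmono : mono = true → F.PositiveInA)
    {π : ProofGraph Λ} (hπ : ∀ i C s, π[i]? = some (C, s) → S.StepOK F.pre F.matrix π i C s)
    (hval : ∀ i C s, π[i]? = some (C, s) → val i = lineValue F mono α val s) {i : ℕ}
    {E : List Λ} {s : Source} (hi : π[i]? = some (E, s))
    (hE : Falsified F mono (val i) α (R.lits E)) : R.Holds (val i) α E := by
  induction i using Nat.strong_induction_on generalizing E s with
  | _ i ih =>
  have hstep := hπ i E s hi
  rw [hval i E s hi] at hE ⊢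
  cases s with
  | leaf k =>
    obtain ⟨K, hK, h⟩ := hstep
    exact R.holds_leaf hmono (Instance.mem_sideCNF_of_getElem? hK) h hE
  | unary j =>
    obtain ⟨hj, C, ⟨s, hC⟩, h⟩ := hstep
    exact R.unary h (ih j hj hC fun l hl hlp => hE l (R.unary_lits h l hl hlp) hlp)
  | res j k x =>
    obtain ⟨hj, hk, C, D, ⟨s, hC⟩, ⟨t, hD⟩, h⟩ := hstep
    exact R.holds_res (P := fun b => cond b C D) hF h
      (Bool.forall_bool.2 ⟨ih k hk hD, ih j hj hC⟩) hE

end SideSemantics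

/-- Line values along an `S`-refutation of a well-formed instance interpolate. -/
def Interpolates {Λ : Type} (S : Calculus Λ) : Prop :=
  ∀ (F : Instance) (π : ProofGraph Λ), F.WellFormed → S.Refutes F.pre F.matrix π →
    ∀ (mono : Bool) (α val : ℕ → Bool), (mono = true → F.PositiveInA) →
      (∀ i C s, π[i]? = some (C, s) → val i = lineValue F mono α val s) →
      ¬ QTrue (F.sidePrefix (val (π.length - 1))) (F.sideCNF (val (π.length - 1))) α

section Interpolates

variable {Λ : Type} {S T : Calculus Λ}

theorem Interpolates.of_sideSemantics
    (R : ∀ F : Instance, F.WellFormed → Nonempty (SideSemantics S F)) : Interpolates S := by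
  intro F π hF hπ mono α val hmono hval
  obtain ⟨R⟩ := R F hF
  obtain ⟨hstep, ⟨t, hlast⟩, -⟩ := hπ
  rw [List.getLast?_eq_getElem?] at hlast
  refine R.not_qTrue (R.holds hF hmono hstep hval hlast fun l hl => ?_)
  simp only [R.lits_nil, Set.mem_empty_iff_false] at hl

/-- Interpolation passes from `T` to `S` if, on lines with an invariant `Inv` of `S`, every rule of
`S` is a rule of `T`. -/
theorem Interpolates.of_le (hT : Interpolates T) (Inv : List Λ → Prop)
    (shape : ∀ π, S.shape π → T.shape π)
    (leaf : ∀ {Q K C}, (∀ x : ℕ, ¬ ((x, true) ∈ K ∧ (x, false) ∈ K)) → S.leafRule Q K C →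
      T.leafRule Q K C ∧ Inv C)
    (unary : ∀ {Q C D}, Inv C → S.unaryRule Q C D → T.unaryRule Q C D ∧ Inv D)
    (res : ∀ {Q x C D E}, Inv C → Inv D → S.resRule Q x C D E → T.resRule Q x C D E ∧ Inv E) :
    Interpolates S := by
  intro F π hF hπ
  suffices h : ∀ i C s, π[i]? = some (C, s) → T.StepOK F.pre F.matrix π i C s ∧ Inv C from
    hT F π hF ⟨fun i C s hi => (h i C s hi).1, hπ.2.1, shape _ hπ.2.2⟩
  intro i
  induction i using Nat.strong_induction_on with
  | _ i ih =>
  intro E s hi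
  have hstep := hπ.1 i E s hi
  cases s with
  | leaf k =>
    obtain ⟨K, hK, h⟩ := hstep
    obtain ⟨hrule, hinv⟩ := leaf (hF.nontaut K (List.mem_of_getElem? hK)) h
    exact ⟨⟨K, hK, hrule⟩, hinv⟩
  | unary j =>
    obtain ⟨hj, C, ⟨s, hC⟩, h⟩ := hstep
    obtain ⟨hrule, hinv⟩ := unary (ih j hj C s hC).2 h
    exact ⟨⟨hj, C, ⟨s, hC⟩, hrule⟩, hinv⟩
  | res j k x =>
    obtain ⟨hj, hk, C, D, ⟨s, hC⟩, ⟨t, hD⟩, h⟩ := hstep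
    obtain ⟨hrule, hinv⟩ := res (ih j hj C s hC).2 (ih k hk D t hD).2 h
    exact ⟨⟨hj, hk, C, D, ⟨s, hC⟩, ⟨t, hD⟩, hrule⟩, hinv⟩

end Interpolates

/-! ### Clauses with merged literals -/

theorem toMLit_injective : Function.Injective Lit.toMLit := by
  rintro ⟨x, _ | _⟩ ⟨y, _ | _⟩ h <;> simp_all [Lit.toMLit]

theorem toMLit_ne_star (l : Lit) : (Lit.toMLit l).2 ≠ Sign.star := by
  rcases l with ⟨x, _ | _⟩ <;> simp [Lit.toMLit]

namespace CDCL

/-- No variable occurs in two literals of the clause. -/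
def Consistent (C : Set MLit) : Prop := Set.InjOn Prod.fst C

/-- `Entails φ Q α C`: with the variables outside `Q` read off from `α`, the universal player wins
`Q. φ` as long as the existential player keeps `C` falsified. A merged literal stands for one value
of its variable that may depend on the earlier variables; the first alternative at a universal
variable expresses that the universal player wins from there on, whatever happens to `C`. -/
def Entails (φ : CNF) : Prefix → (ℕ → Bool) → Set MLit → Prop
  | [], α, _ => ¬ φ.Sat α
  | (Quant.ex, x) :: Q, α, C =>
      ∀ b, Lit.toMLit (x, b) ∈ C ∨ Entails φ Q (Function.update α x b) C
  | (Quant.all, u) :: Q, α, C =>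
      (∃ b, Entails φ Q (Function.update α u b) ∅) ∨
      ((u, Sign.star) ∈ C ∧ ∃ b, Entails φ Q (Function.update α u b) C) ∨
      ∀ b, Lit.toMLit (u, b) ∈ C ∨ Entails φ Q (Function.update α u b) C

variable {φ : CNF} {P Q : Prefix} {α : ℕ → Bool} {C D E : Set MLit} {a : Quant × ℕ} {x : ℕ}

theorem Consistent.toMLit_notMem (hC : Consistent C) {b : Bool} (hb : Lit.toMLit (x, b) ∈ C) :
    Lit.toMLit (x, !b) ∉ C := fun hb' =>
  Bool.self_ne_not b (congrArg Prod.snd (toMLit_injective (hC hb hb' rfl)))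

theorem Consistent.star_notMem (hC : Consistent C) {b : Bool} (hb : Lit.toMLit (x, b) ∈ C) :
    (x, Sign.star) ∉ C := fun hs =>
  toMLit_ne_star (x, b) (congrArg Prod.snd (hC hb hs rfl))

theorem Consistent.exists_of_forall_or (hC : Consistent C) {p : Bool → Prop}
    (h : ∀ b, Lit.toMLit (x, b) ∈ C ∨ p b) : ∃ b, p b := by
  by_cases ht : Lit.toMLit (x, true) ∈ C
  · exact ⟨false, (h false).resolve_left (hC.toMLit_notMem ht)⟩
  · exact ⟨true, (h true).resolve_left ht⟩

namespace Entails

theorem not_qTrue (h : Entails φ Q α ∅) : ¬ QTrue Q φ α := by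
  induction Q generalizing α with
  | nil => exact h
  | cons a Q ih =>
    obtain ⟨_ | _, x⟩ := a
    · rintro ⟨b, hb⟩
      exact ih ((h b).resolve_left id) hb
    · intro hq
      obtain ⟨b, hb⟩ | ⟨⟨⟩, -⟩ | h := h
      · exact ih hb (hq b)
      · exact ih ((h true).resolve_left id) (hq true)

theorem weaken (hQ : IsBlock P Q) (hC : Consistent C)
    (hCD : ∀ l ∈ C, l.1 ∈ Q.map Prod.snd → l ∈ D ∨ IsAll P l.1 ∧ (l.1, Sign.star) ∈ D)
    (h : Entails φ Q α C) : Entails φ Q α D := by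
  induction Q generalizing α with
  | nil => exact h
  | cons a Q ih =>
    have ih' : ∀ {β}, Entails φ Q β C → Entails φ Q β D := fun {β} =>
      ih hQ.tail fun l hl hlQ => hCD l hl (List.mem_cons_of_mem _ hlQ)
    obtain ⟨_ | _, x⟩ := a
    · refine fun b => (h b).imp (fun hb => ?_) ih'
      exact (hCD _ hb List.mem_cons_self).resolve_right fun hD =>
        (hQ.isEx List.mem_cons_self).not_isAll hQ.nodup hD.1
    · obtain h | ⟨hs, b, hb⟩ | h := h
      · exact Or.inl h
      · exact Or.inr (Or.inl ⟨(hCD _ hs List.mem_cons_self).elim id And.right, b, ih' hb⟩)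
      · by_cases hx : (x, Sign.star) ∈ D
        · obtain ⟨b, hb⟩ := hC.exists_of_forall_or h
          exact Or.inr (Or.inl ⟨hx, b, ih' hb⟩)
        · refine Or.inr (Or.inr fun b => (h b).imp (fun hb => ?_) ih')
          exact (hCD _ hb List.mem_cons_self).resolve_right fun hD => hx hD.2

theorem of_mem {K : List Lit} (hK : K ∈ φ)
    (hC : ∀ l ∈ K, l.1 ∈ Q.map Prod.snd → Lit.toMLit l ∈ C)
    (hα : ∀ l ∈ K, l.1 ∉ Q.map Prod.snd → α l.1 ≠ l.2) : Entails φ Q α C := by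
  induction Q generalizing α with
  | nil =>
    intro hsat
    obtain ⟨l, hl, hαl⟩ := hsat K hK
    exact hα l hl List.not_mem_nil hαl
  | cons a Q ih =>
    have forall_or (b : Bool) :
        Lit.toMLit (a.2, b) ∈ C ∨ Entails φ Q (Function.update α a.2 b) C := by
      refine or_iff_not_imp_left.2 fun hb =>
        ih (fun l hl hlQ => hC l hl (List.mem_cons_of_mem _ hlQ)) fun l hl hlQ => ?_
      by_cases hla : l.1 = a.2
      · rw [hla, Function.update_self]
        rintro rfl
        exact hb (hla ▸ hC l hl (hla ▸ List.mem_cons_self))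
      · rw [Function.update_of_ne hla]
        exact hα l hl fun hl' => hlQ ((List.mem_cons.1 hl').resolve_left hla)
    obtain ⟨_ | _, x⟩ := a
    · exact forall_or
    · exact Or.inr (Or.inr forall_or)

theorem of_no_existential (hC : Consistent C) (hex : ∀ l ∈ C, ¬ IsEx Q l.1)
    (h : Entails φ Q α C) : Entails φ Q α ∅ := by
  induction Q generalizing α with
  | nil => exact h
  | cons a Q ih =>
    have ih' : ∀ {β}, Entails φ Q β C → Entails φ Q β ∅ := fun {β} =>
      ih fun l hl hlQ => hex l hl (List.mem_cons_of_mem _ hlQ)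
    obtain ⟨_ | _, x⟩ := a
    · exact fun b => Or.inr (ih' ((h b).resolve_left fun hb => hex _ hb List.mem_cons_self))
    · obtain h | ⟨-, b, hb⟩ | h := h
      · exact Or.inl h
      · exact Or.inl ⟨b, ih' hb⟩
      · exact Or.inl ((hC.exists_of_forall_or h).imp fun b => ih')

theorem exists_of_no_existential (hC : Consistent C) (hex : ∀ l ∈ C, ¬ IsEx Q l.1)
    (h : Entails φ ((Quant.all, x) :: Q) α C) :
    ∃ b, Entails φ Q (Function.update α x b) ∅ := by
  obtain h | ⟨-, h⟩ | h := h
  · exact h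
  · exact h.imp fun b => of_no_existential hC hex
  · exact (hC.exists_of_forall_or h).imp fun b => of_no_existential hC hex

end Entails

/-- `D` arises from `C` by `∀-Red` or `∀-Red*`. -/
def ReducesTo (P : Prefix) (C D : Set MLit) : Prop :=
  ∃ l ∈ C, IsAll P l.1 ∧ D = C \ {l} ∧ ∀ k ∈ D, IsEx P k.1 → idx P k.1 ≤ idx P l.1

theorem URed.reducesTo (h : URed P C D) : ReducesTo P C D :=
  h.imp fun _ hl => ⟨hl.1, hl.2.2⟩

theorem URedStar.reducesTo (h : URedStar P C D) : ReducesTo P C D :=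
  h.imp fun _ hl => ⟨hl.1, hl.2.2⟩

theorem ReducesTo.consistent (h : ReducesTo P C D) (hC : Consistent C) : Consistent D := by
  obtain ⟨l, -, -, rfl, -⟩ := h
  exact hC.mono Set.sdiff_subset

theorem ReducesTo.entails (h : ReducesTo P C D) (hQ : IsBlock P Q) (hC : Consistent C)
    (hCα : Entails φ Q α C) : Entails φ Q α D := by
  obtain ⟨l, -, hall, rfl, hidx⟩ := h
  induction Q generalizing α with
  | nil => exact hCα
  | cons a Q ih =>
    have mem_of_ne {y : ℕ} {s : Sign} (hy : l.1 ≠ y) (hs : (y, s) ∈ C) : (y, s) ∈ C \ {l} :=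
      ⟨hs, fun he => hy (congrArg Prod.fst he.symm)⟩
    have ih' : ∀ {β}, Entails φ Q β C → Entails φ Q β (C \ {l}) := ih hQ.tail
    obtain ⟨_ | _, x⟩ := a
    · have hlx : l.1 ≠ x := fun he => (hQ.isEx List.mem_cons_self).not_isAll hQ.nodup (he ▸ hall)
      exact fun b => (hCα b).imp (mem_of_ne hlx) ih'
    by_cases hlx : l.1 = x
    · refine Or.inl (hCα.exists_of_no_existential hC fun k hk hkQ => ?_)
      have hlt : idx P l.1 < idx P k.1 := hlx ▸ hQ.idx_lt hkQ.mem
      exact hlt.not_ge (hidx k ⟨hk, fun he => hlt.ne (congrArg (idx P ·.1) he.symm)⟩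
        (hQ.tail.isEx hkQ))
    · obtain h | ⟨hs, b, hb⟩ | h := hCα
      · exact Or.inl h
      · exact Or.inr (Or.inl ⟨mem_of_ne hlx hs, b, ih' hb⟩)
      · exact Or.inr (Or.inr fun b => (h b).imp (mem_of_ne hlx) ih')

/-- What soundness needs to know about a long-distance resolution on `x` of consistent clauses,
where `S b` is the premise that contains `x` with sign `b`. -/
structure IsResolvent (P : Prefix) (x : ℕ) (S : Bool → Set MLit) (E : Set MLit) : Prop where
  consistent : ∀ b, Consistent (S b)
  pivot : ∀ b, Lit.toMLit (x, b) ∈ S b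
  mem : ∀ b, ∀ l ∈ S b, l ≠ Lit.toMLit (x, b) →
    l ∈ E ∨ IsAll P l.1 ∧ idx P x < idx P l.1 ∧ (l.1, Sign.star) ∈ E
  star : ∀ b u s, (u, Sign.star) ∈ S b → (u, s) ∈ S (!b) → idx P x < idx P u

namespace IsResolvent

variable {S : Bool → Set MLit}

theorem discard (h : IsResolvent P x S E) (hQ : IsBlock P Q) (hx : x ∉ Q.map Prod.snd) (b : Bool)
    (hS : Entails φ Q α (S b)) : Entails φ Q α E := by
  refine hS.weaken hQ (h.consistent b) fun l hl hlQ => ?_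
  refine (h.mem b l hl ?_).imp_right fun hE => ⟨hE.1, hE.2.2⟩
  rintro rfl
  exact hx hlQ

/-- After the value `b` of the pivot, the premise that contains the opposite literal implies the
resolvent. -/
theorem entails_of_head_eq {q : Quant} (h : IsResolvent P x S E) (hQ : IsBlock P ((q, x) :: Q))
    (hS : ∀ b, Entails φ ((q, x) :: Q) α (S b)) : Entails φ ((q, x) :: Q) α E := by
  have entails_update (hS : ∀ b c, Lit.toMLit (x, c) ∈ S b ∨
      Entails φ Q (Function.update α x c) (S b)) (c : Bool) :
      Entails φ Q (Function.update α x c) E := by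
    refine h.discard hQ.tail hQ.notMem_tail (!c) ((hS (!c) c).resolve_left fun hc => ?_)
    exact (h.consistent (!c)).toMLit_notMem hc (h.pivot (!c))
  cases q with
  | ex => exact fun c => Or.inr (entails_update hS c)
  | all =>
    by_cases hwin : ∃ c, Entails φ Q (Function.update α x c) ∅
    · exact Or.inl hwin
    · refine Or.inr (Or.inr fun c => Or.inr (entails_update (fun b => ?_) c))
      exact ((hS b).resolve_left hwin).resolve_left fun hs =>
        (h.consistent b).star_notMem (h.pivot b) hs.1

/-- Before the pivot no literals are merged by the resolution step, so that the premises can be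
followed simultaneously. -/
theorem entails_of_head_lt {q : Quant} {v : ℕ} (h : IsResolvent P x S E)
    (hv : idx P v < idx P x)
    (ih : ∀ {β}, (∀ b, Entails φ Q β (S b)) → Entails φ Q β E)
    (hS : ∀ b, Entails φ ((q, v) :: Q) α (S b)) : Entails φ ((q, v) :: Q) α E := by
  have mem {b : Bool} {s : Sign} (hs : (v, s) ∈ S b) : (v, s) ∈ E := by
    refine (h.mem b _ hs fun he => ?_).resolve_right fun hE => hv.not_gt hE.2.1
    exact hv.ne (congrArg (idx P ·.1) he)
  have forall_or (hS : ∀ b c, Lit.toMLit (v, c) ∈ S b ∨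
      Entails φ Q (Function.update α v c) (S b)) (c : Bool) :
      Lit.toMLit (v, c) ∈ E ∨ Entails φ Q (Function.update α v c) E := by
    by_cases hc : ∃ b, Lit.toMLit (v, c) ∈ S b
    · exact Or.inl (mem hc.choose_spec)
    · exact Or.inr (ih fun b => (hS b c).resolve_left fun hb => hc ⟨b, hb⟩)
  cases q with
  | ex => exact forall_or hS
  | all =>
    by_cases hwin : ∃ c, Entails φ Q (Function.update α v c) ∅
    · exact Or.inl hwin
    by_cases hstar : ∃ b, (v, Sign.star) ∈ S b ∧ ∃ c, Entails φ Q (Function.update α v c) (S b)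
    · obtain ⟨b, hs, c, hc⟩ := hstar
      have notMem (s : Sign) : (v, s) ∉ S (!b) := fun hs' => hv.not_gt (h.star b v s hs hs')
      have hnot := ((hS (!b)).resolve_left hwin).resolve_left fun hs' => notMem _ hs'.1
      exact Or.inr (Or.inl ⟨mem hs, c,
        ih ((Bool.forall_bool' b).2 ⟨hc, (hnot c).resolve_left (notMem _)⟩)⟩)
    · exact Or.inr (Or.inr (forall_or fun b =>
        ((hS b).resolve_left hwin).resolve_left fun hs => hstar ⟨b, hs⟩))

theorem entails (h : IsResolvent P x S E) (hQ : IsBlock P Q) (hS : ∀ b, Entails φ Q α (S b)) :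
    Entails φ Q α E := by
  induction Q generalizing α with
  | nil => exact hS true
  | cons a Q ih =>
    by_cases hx : x ∈ (a :: Q).map Prod.snd
    · obtain ⟨q, v⟩ := a
      obtain rfl | hx := List.mem_cons.1 hx
      · exact h.entails_of_head_eq hQ hS
      · exact h.entails_of_head_lt (hQ.idx_lt hx) (ih hQ.tail) hS
    · exact h.discard hQ hx true (hS true)

end IsResolvent

theorem LRes.exists_parts (h : LRes P x C D E) : ∃ K U : Bool → Set MLit,
    (∀ b, cond b C D = K b ∪ U b ∪ {Lit.toMLit (x, b)}) ∧
    E = K true ∪ K false ∪ (fun u => (u, Sign.star)) '' (Prod.fst '' U true) ∧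
    (∀ b, Disjoint (K b) (U b)) ∧
    (∀ b, ∀ l ∈ K b, ∀ k ∈ K (!b), l.1 = k.1 → l = k ∧ l.2 ≠ Sign.star) ∧
    (∀ b, ∀ l ∈ U b, IsAll P l.1 ∧ idx P x < idx P l.1) ∧
    ∀ b, Prod.fst '' U b = Prod.fst '' U true := by
  obtain ⟨C₁, U₁, C₂, U₂, hC, -, hCeq, hD, -, hDeq, hCD, hU, hvar, -, hE⟩ := h
  refine ⟨fun b => cond b C₁ C₂, fun b => cond b U₁ U₂, Bool.forall_bool.2 ⟨hDeq, hCeq⟩, hE,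
    Bool.forall_bool.2 ⟨hD, hC⟩, Bool.forall_bool.2 ⟨fun l hl k hk he => ?_, hCD⟩,
    Bool.forall_bool.2 ⟨fun l hl => hU l (Or.inr hl), fun l hl => hU l (Or.inl hl)⟩,
    Bool.forall_bool.2 ⟨hvar.symm, rfl⟩⟩
  obtain ⟨rfl, hs⟩ := hCD k hk l hl he.symm
  exact ⟨rfl, hs⟩

theorem fst_ne_of_parts {K U : Bool → Set MLit} {m : Bool → MLit}
    (hS : ∀ b, Consistent (K b ∪ U b ∪ {m b})) (hdisj : ∀ b, Disjoint (K b) (U b))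
    (hvar : ∀ b, Prod.fst '' U b = Prod.fst '' U true) {b c : Bool} {l k : MLit} (hl : l ∈ K b)
    (hk : k ∈ U c) : l.1 ≠ k.1 := by
  intro he
  obtain ⟨k', hk', he'⟩ : k.1 ∈ Prod.fst '' U b :=
    (hvar b).symm ▸ hvar c ▸ Set.mem_image_of_mem _ hk
  refine Set.disjoint_left.1 (hdisj b) hl ?_
  rwa [hS b (Or.inl (Or.inl hl)) (Or.inl (Or.inr hk')) (he.trans he'.symm)]

theorem LRes.isResolvent (h : LRes P x C D E) (hC : Consistent C) (hD : Consistent D) :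
    IsResolvent P x (fun b => cond b C D) E := by
  obtain ⟨K, U, hS, rfl, hdisj, hK, hU, hvar⟩ := h.exists_parts
  have hcons : ∀ b, Consistent (cond b C D) := Bool.forall_bool.2 ⟨hD, hC⟩
  simp only [hS] at hcons ⊢
  have hne : ∀ {b c} {l k : MLit}, l ∈ K b → k ∈ U c → l.1 ≠ k.1 :=
    fst_ne_of_parts hcons hdisj hvar
  refine ⟨hcons, fun b => Or.inr rfl, ?_, ?_⟩
  · rintro b l ((hl | hl) | hl) hlx
    · exact Or.inl (Or.inl (by cases b; exacts [Or.inr hl, Or.inl hl]))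
    · exact Or.inr ⟨(hU b l hl).1, (hU b l hl).2,
        Or.inr ⟨l.1, hvar b ▸ Set.mem_image_of_mem _ hl, rfl⟩⟩
    · exact absurd hl hlx
  · rintro b u s ((hu | hu) | hu) hs
    · obtain (hs | hs) | hs := hs
      · exact absurd rfl (hK b _ hu _ hs rfl).2
      · exact (hne hu hs rfl).elim
      · obtain rfl : u = x := congrArg Prod.fst hs
        exact absurd (Or.inl (Or.inl hu)) ((hcons b).star_notMem (Or.inr rfl))
    · exact (hU b _ hu).2
    · exact absurd (congrArg Prod.snd hu).symm (toMLit_ne_star _)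

theorem LRes.consistent (h : LRes P x C D E) (hC : Consistent C) (hD : Consistent D) :
    Consistent E := by
  obtain ⟨K, U, hS, rfl, hdisj, hK, -, hvar⟩ := h.exists_parts
  have hcons : ∀ b, Consistent (cond b C D) := Bool.forall_bool.2 ⟨hD, hC⟩
  simp only [hS] at hcons
  have hKU : ∀ l ∈ K true ∪ K false, ∀ k ∈ U true, l.1 ≠ k.1 := by
    rintro l (hl | hl) k hk
    · exact fst_ne_of_parts hcons hdisj hvar hl hk
    · exact fst_ne_of_parts hcons hdisj hvar hl hk
  rintro l (hl | ⟨_, ⟨l, hl, rfl⟩, rfl⟩) k (hk | ⟨_, ⟨k, hk, rfl⟩, rfl⟩) he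
  · rcases hl with hl | hl <;> rcases hk with hk | hk
    · exact hcons true (Or.inl (Or.inl hl)) (Or.inl (Or.inl hk)) he
    · exact (hK true l hl k hk he).1
    · exact (hK false l hl k hk he).1
    · exact hcons false (Or.inl (Or.inl hl)) (Or.inl (Or.inl hk)) he
  · exact absurd he (hKU l hl k hk)
  · exact absurd he.symm (hKU k hk l hl)
  · exact Prod.ext he rfl

theorem SRes.lRes (h : SRes x C D E) (hC : ∀ l ∈ C, l.2 ≠ Sign.star)
    (hD : ∀ l ∈ D, l.2 ≠ Sign.star) : LRes P x C D E := by
  obtain ⟨C₁, C₂, hxC, rfl, hxD, rfl, hz, rfl⟩ := h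
  refine ⟨C₁, ∅, C₂, ∅, by simp, by simpa using hxC, by simp, by simp, by simpa using hxD, by simp,
    ?_, by simp, rfl, by simp, by simp⟩
  rintro ⟨y, s⟩ hl ⟨z, t⟩ hk (rfl : y = z)
  have hs := hC _ (Or.inl hl)
  have ht := hD _ (Or.inl hk)
  refine ⟨?_, hs⟩
  have := hz _ hl
  cases s <;> cases t <;> simp_all [Sign.compl]

/-- The steps of LQU⁺-Res on consistent clauses, as far as soundness is concerned. -/
def calculus : Calculus MLit where
  leafRule := Leaf
  unaryRule P C D := Consistent (litSet C) ∧ ReducesTo P (litSet C) (litSet D)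
  resRule P x C D E := IsResolvent P x (fun b => cond b (litSet C) (litSet D)) (litSet E)
  shape _ := True

theorem calculus_resRule {S : Bool → List MLit} {E : List MLit} :
    calculus.resRule P x (S true) (S false) E ↔
      IsResolvent P x (fun b => litSet (S b)) (litSet E) := by
  have hS : (fun b => cond b (litSet (S true)) (litSet (S false))) = fun b => litSet (S b) :=
    funext (Bool.forall_bool.2 ⟨rfl, rfl⟩)
  rw [← hS]
  rfl

/-- The semantics of `CDCL.calculus` given by `Entails`. -/
def sideSemantics {F : Instance} (hF : F.WellFormed) : SideSemantics calculus F where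
  lits C := {l | Lit.toMLit l ∈ litSet C}
  Holds s α C := Entails (F.sideCNF s) (F.sidePrefix s) α (litSet C)
  leaf_lits {K C} (h : litSet C = _) l hl _ := h ▸ Set.mem_image_of_mem _ hl
  leaf {s α K C} hK (h : litSet C = _) hα := by
    refine Entails.of_mem hK (fun l hl _ => h ▸ Set.mem_image_of_mem _ hl) fun l hl hlQ => ?_
    exact hα l hl ((hF.mem_p_or_mem_side hK hl).resolve_right hlQ)
  unary_lits {C D} h k hk hkp := by
    obtain ⟨-, l, -, hall, hD, -⟩ := h
    exact hD ▸ ⟨hk, fun he => hF.not_isAll_of_mem_p hkp (congrArg Prod.fst he ▸ hall)⟩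
  unary {s _ _ _} h hα := h.2.entails (hF.isBlock s) h.1 hα
  res_lits {x S E} h b l hl hlp hlx := by
    rw [calculus_resRule] at h
    exact (h.mem b _ hl fun he => hlx (toMLit_injective he)).resolve_right fun hE =>
      hF.not_isAll_of_mem_p hlp hE.1
  res_discard {s _ _ S _} h hx b hα := by
    rw [calculus_resRule] at h
    exact h.discard (hF.isBlock s) hx b hα
  res {s _ _ S _} h hα := by
    rw [calculus_resRule] at h
    exact h.entails (hF.isBlock s) hα
  lits_nil := by simp [litSet]
  not_qTrue h := Entails.not_qTrue (by simpa [litSet] using h)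

theorem Leaf.consistent {K : List Lit} {C : List MLit} (h : Leaf Q K C)
    (hK : ∀ x : ℕ, ¬ ((x, true) ∈ K ∧ (x, false) ∈ K)) : Consistent (litSet C) := by
  rw [show litSet C = _ from h]
  rintro _ ⟨⟨x, b⟩, hl, rfl⟩ _ ⟨⟨y, c⟩, hk, rfl⟩ (rfl : x = y)
  cases b <;> cases c
  · rfl
  · exact absurd ⟨hk, hl⟩ (hK x)
  · exact absurd ⟨hl, hk⟩ (hK x)
  · rfl

theorem interpolates_calculus : Interpolates calculus :=
  .of_sideSemantics fun _ hF => ⟨sideSemantics hF⟩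

end CDCL

theorem interpolates_lquPlusRes : Interpolates lquPlusRes := by
  refine CDCL.interpolates_calculus.of_le (fun C => CDCL.Consistent (litSet C)) (fun _ h => h)
    (fun {Q K C} hK h => ⟨h, CDCL.Leaf.consistent (Q := Q) h hK⟩) (fun hC h => ?_)
    fun hC hD h => ⟨h.2.isResolvent hC hD, h.2.consistent hC hD⟩
  have hred := h.elim CDCL.URed.reducesTo CDCL.URedStar.reducesTo
  exact ⟨⟨hC, hred⟩, hred.consistent hC⟩

theorem interpolates_ldQRes : Interpolates ldQRes :=
  interpolates_lquPlusRes.of_le (fun _ => True) (fun _ h => h) (fun _ h => ⟨h, trivial⟩)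
    (fun _ h => ⟨h, trivial⟩) fun _ _ h => ⟨⟨Or.inl h.1, h.2⟩, trivial⟩

theorem interpolates_quRes : Interpolates quRes := by
  refine interpolates_lquPlusRes.of_le (fun C => ∀ l ∈ litSet C, l.2 ≠ Sign.star) (fun _ h => h)
    (fun {Q K C} _ h => ⟨h, ?_⟩) (fun {Q C D} hC h => ⟨Or.inl h, ?_⟩)
    (fun {Q x C D E} hC hD h => ⟨⟨h.1, h.2.lRes hC hD⟩, ?_⟩)
  · rw [show litSet C = _ from h]
    rintro _ ⟨l, -, rfl⟩
    exact toMLit_ne_star l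
  · obtain ⟨l, -, -, -, hD, -⟩ := h
    rw [hD]
    exact fun k hk => hC k hk.1
  · obtain ⟨-, C₁, C₂, -, h1, -, h2, -, hE⟩ := h
    rw [hE]
    rintro l (hl | hl)
    · exact hC l (h1 ▸ Or.inl hl)
    · exact hD l (h2 ▸ Or.inl hl)

theorem interpolates_qRes : Interpolates qRes :=
  interpolates_quRes.of_le (fun _ => True) (fun _ h => h) (fun _ h => ⟨h, trivial⟩)
    (fun _ h => ⟨h, trivial⟩) fun _ _ h => ⟨⟨Or.inl h.1, h.2⟩, trivial⟩

theorem interpolates_treeQRes : Interpolates treeQRes :=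
  interpolates_qRes.of_le (fun _ => True) (fun _ _ => trivial) (fun _ h => ⟨h, trivial⟩)
    (fun _ h => ⟨h, trivial⟩) fun _ _ h => ⟨h, trivial⟩

/-! ### Annotated clauses -/

namespace Expansion

/-- The value `b` of a universal variable, written in an annotation. -/
def boolVal (b : Bool) : AVal := if b then AVal.one else AVal.zero

/-- `Matches o a`: the entry `a` of an annotation is in line with the commitment `o` of the
universal player, who fixes a value of the variable in advance (`some b`) or leaves it open
(`none`). -/
def Matches : Option Bool → Option AVal → Prop
  | none, a => a = none
  | some b, a => a = some (boolVal b) ∨ a = some AVal.star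

/-- The literals of `C` whose annotation at `u` is in line with the commitment `o`. -/
def select (u : ℕ) (o : Option Bool) (C : Set (Lit × Ann)) : Set (Lit × Ann) :=
  {l ∈ C | Matches o (l.2 u)}

/-- `Entails φ Q α C`: with the variables outside `Q` read off from `α`, the universal player wins
`Q. φ` as long as the existential player keeps `C` falsified. At a universal variable the player
chooses a commitment, after which only the literals in line with it still count. -/
def Entails (φ : CNF) : Prefix → (ℕ → Bool) → Set (Lit × Ann) → Prop
  | [], α, _ => ¬ φ.Sat α
  | (Quant.ex, x) :: Q, α, C =>
      ∀ b, (∃ σ, ((x, b), σ) ∈ C) ∨ Entails φ Q (Function.update α x b) C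
  | (Quant.all, u) :: Q, α, C =>
      ∃ o : Option Bool, ∀ b, Entails φ Q (Function.update α u (o.getD b)) (select u o C)

/-- The entry `d` of an annotation is `c`, or arises from `c` by merging. -/
def Coarsens (c d : Option AVal) : Prop := d = c ∨ c ≠ none ∧ d = some AVal.star

/-- Instantiation by `τ` and merging turn the literals of `C` into literals of `D`, as far as the
variables of `Q` are concerned. Indices refer to the whole prefix `P`. -/
def Embeds (P Q : Prefix) (τ : Ann) (C D : Set (Lit × Ann)) : Prop :=
  ∀ l ∈ C, IsEx Q l.1.1 → ∃ σ, (l.1, σ) ∈ D ∧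
    ∀ u, IsAll Q u → idx P u < idx P l.1.1 → Coarsens ((l.2 u).or (τ u)) (σ u)

variable {φ : CNF} {P Q : Prefix} {α : ℕ → Bool} {τ : Ann} {C D E : Set (Lit × Ann)}
  {a : Quant × ℕ} {u x : ℕ} {o o' : Option Bool} {c d : Option AVal}

theorem boolVal_injective : Function.Injective boolVal := by
  rintro (_ | _) (_ | _) h <;> first | rfl | cases h

theorem exists_matches : ∀ c, ∃ o, Matches o c
  | none => ⟨none, rfl⟩
  | some AVal.zero => ⟨some false, Or.inl rfl⟩
  | some AVal.one => ⟨some true, Or.inl rfl⟩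
  | some AVal.star => ⟨some true, Or.inr rfl⟩

theorem matches_none_iff : Matches o none ↔ o = none := by
  cases o <;> simp [Matches]

theorem Matches.eq_of_boolVal {b : Bool} (h : Matches o (some (boolVal b))) : o = some b := by
  rcases o with _ | b'
  · cases h
  · obtain h | h := h
    · rw [boolVal_injective (Option.some_inj.1 h)]
    · cases b <;> cases h

theorem Matches.or (h : Matches o c) (h' : Matches o' d) : Matches (o.or o') (c.or d) := by
  rcases o with _ | b
  · obtain rfl := h
    exact h'
  · obtain rfl | rfl := h
    · exact Or.inl rfl
    · exact Or.inr rfl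

theorem Matches.coarsens (h : Matches o c) (hcd : Coarsens c d) : Matches o d := by
  obtain rfl | ⟨hc, rfl⟩ := hcd
  · exact h
  · rcases o with _ | b
    · exact absurd h hc
    · exact Or.inr rfl

theorem getD_or (o o' : Option Bool) (b : Bool) : (o.or o').getD b = o.getD (o'.getD b) := by
  cases o <;> rfl

/-- Commitments in line with the annotations `τ ∪ ρ true` and `τ ∪ ρ false` of the pivot literals
amount to a common one once either side is instantiated by the annotation of the other. -/
theorem exists_common_commitment {ρ : Bool → Ann} (hτ : τ.Binary)
    (hρ : Disjoint (ρ true).dom (ρ false).dom) {o : Bool → Option Bool}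
    (ho : ∀ b, Matches (o b) (τ.complete (ρ b) u)) :
    ∃ o', ∀ b, ∃ p, Matches p (ρ (!b) u) ∧ (o b).or p = o' := by
  simp only [Ann.complete] at ho
  cases hτu : τ u with
  | none =>
    simp only [hτu, Option.none_or] at ho
    refine ⟨(o true).or (o false), Bool.forall_bool.2
      ⟨⟨o true, ho true, ?_⟩, ⟨o false, ho false, rfl⟩⟩⟩
    by_cases hu : ρ true u = none
    · have hot := ho true
      rw [hu, matches_none_iff] at hot
      rw [hot, Option.or_none, Option.none_or]
    · have hof := ho false
      rw [not_not.1 (Set.disjoint_left.1 hρ hu), matches_none_iff] at hof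
      rw [hof, Option.or_none, Option.none_or]
  | some c =>
    obtain ⟨b, rfl⟩ : ∃ b, c = boolVal b := by
      cases c
      exacts [⟨false, rfl⟩, ⟨true, rfl⟩, absurd hτu (hτ u)]
    refine ⟨some b, fun b' => ?_⟩
    obtain ⟨p, hp⟩ := exists_matches (ρ (!b') u)
    have hob : Matches (o b') (some (boolVal b)) := by simpa only [hτu, Option.some_or] using ho b'
    exact ⟨p, hp, by rw [hob.eq_of_boolVal, Option.some_or]⟩

theorem select_sdiff (k : Lit × Ann) : select u o (C \ {k}) = select u o C \ {k} := by
  ext l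
  exact and_right_comm

theorem select_sdiff_of_not_matches {k : Lit × Ann} (hk : ¬ Matches o (k.2 u)) :
    select u o (C \ {k}) = select u o C :=
  Set.ext fun _ => ⟨fun h => ⟨h.1.1, h.2⟩, fun h => ⟨⟨h.1, fun he => hk (he ▸ h.2)⟩, h.2⟩⟩

namespace Embeds

theorem mono {R : Prefix} (hR : R ⊆ Q) (h : Embeds P Q τ C D) : Embeds P R τ C D :=
  fun l hl hlR => (h l hl (hR hlR)).imp fun _ h => ⟨h.1, fun u hu => h.2 u (hR hu)⟩

theorem tail (h : Embeds P (a :: Q) τ C D) : Embeds P Q τ C D :=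
  h.mono (List.subset_cons_self _ _)

theorem select (hQ : IsBlock P ((Quant.all, u) :: Q)) (h : Embeds P ((Quant.all, u) :: Q) τ C D)
    (ho' : Matches o' (τ u)) : Embeds P Q τ (select u o C) (select u (o.or o') D) := by
  intro l hl hlQ
  obtain ⟨σ, hσ, hcoarse⟩ := h l hl.1 (List.mem_cons_of_mem _ hlQ)
  refine ⟨σ, ⟨hσ, ?_⟩, fun v hv => hcoarse v (List.mem_cons_of_mem _ hv)⟩
  exact (hl.2.or ho').coarsens (hcoarse u List.mem_cons_self (hQ.idx_lt hlQ.mem))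

theorem of_inst (h : inst P τ C ⊆ D) : Embeds P P τ C D := by
  refine fun l hl _ => ⟨_, h ⟨l, hl, rfl⟩, fun u hu hidx => Or.inl ?_⟩
  exact if_pos ⟨hu, hidx⟩

theorem of_subset (h : C ⊆ D) : Embeds P Q (fun _ => none) C D :=
  fun l hl _ => ⟨l.2, h hl, fun _ _ _ => Or.inl Option.or_none.symm⟩

end Embeds

theorem coarsens_merge {μ σ : Ann} (h : μ.dom = σ.dom) (u : ℕ) :
    Coarsens (μ u) (μ.merge σ u) ∧ Coarsens (σ u) (μ.merge σ u) := by
  have hnone : μ u ≠ none ↔ σ u ≠ none := Set.ext_iff.1 h u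
  by_cases he : μ u = σ u
  · have hm : μ.merge σ u = μ u := if_pos he
    exact ⟨Or.inl hm, Or.inl (hm.trans he)⟩
  · have hm : μ.merge σ u = some AVal.star := if_neg he
    have hμ : μ u ≠ none := fun h0 =>
      he (h0.trans (not_not.1 fun h1 => hnone.2 h1 h0).symm)
    exact ⟨Or.inr ⟨hμ, hm⟩, Or.inr ⟨hnone.1 hμ, hm⟩⟩

theorem Merging.embeds (h : Merging C D) : Embeds P Q (fun _ => none) C D := by
  obtain ⟨b, μ, σ, -, -, hdom, rfl⟩ := h
  intro l hl _
  simp only [Option.or_none]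
  by_cases hlm : l ∈ ({(b, μ), (b, σ)} : Set (Lit × Ann))
  · obtain rfl | rfl := hlm
    · exact ⟨_, Or.inr rfl, fun u _ _ => (coarsens_merge hdom u).1⟩
    · exact ⟨_, Or.inr rfl, fun u _ _ => (coarsens_merge hdom u).2⟩
  · exact ⟨l.2, Or.inl ⟨hl, hlm⟩, fun _ _ _ => Or.inl rfl⟩

namespace Entails

theorem not_qTrue (h : Entails φ Q α ∅) : ¬ QTrue Q φ α := by
  induction Q generalizing α with
  | nil => exact h
  | cons a Q ih =>
    obtain ⟨_ | _, x⟩ := a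
    · rintro ⟨b, hb⟩
      exact ih ((h b).resolve_left fun ⟨_, h⟩ => h) hb
    · obtain ⟨o, ho⟩ := h
      have hempty : select x o ∅ = ∅ := Set.sep_empty _
      exact fun hq => ih (hempty ▸ ho true) (hq _)

theorem of_embeds (hQ : IsBlock P Q) (hCD : Embeds P Q τ C D) (h : Entails φ Q α C) :
    Entails φ Q α D := by
  induction Q generalizing α C D with
  | nil => exact h
  | cons a Q ih =>
    obtain ⟨_ | _, x⟩ := a
    · refine fun b => (h b).imp (fun ⟨σ, hσ⟩ => ?_) (ih hQ.tail hCD.tail)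
      exact (hCD _ hσ List.mem_cons_self).imp fun _ h => h.1
    · obtain ⟨o, ho⟩ := h
      obtain ⟨o', ho'⟩ := exists_matches (τ x)
      refine ⟨o.or o', fun b => ?_⟩
      rw [getD_or]
      exact ih hQ.tail (hCD.select hQ ho') (ho _)

theorem of_mem {K : List Lit} (hK : K ∈ φ)
    (hall : ∀ l ∈ K, IsAll Q l.1 → τ l.1 = some (boolVal !l.2))
    (hα : ∀ l ∈ K, l.1 ∉ Q.map Prod.snd → α l.1 ≠ l.2) :
    Entails φ Q α ((fun l => (l, τ)) '' litSet K) := by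
  induction Q generalizing α with
  | nil =>
    intro hsat
    obtain ⟨l, hl, hαl⟩ := hsat K hK
    exact hα l hl List.not_mem_nil hαl
  | cons a Q ih =>
    have ih_update {b : Bool} (hb : ∀ l ∈ K, l.1 = a.2 → b ≠ l.2) :
        Entails φ Q (Function.update α a.2 b) ((fun l => (l, τ)) '' litSet K) := by
      refine ih (fun l hl hlQ => hall l hl (List.mem_cons_of_mem _ hlQ)) fun l hl hlQ => ?_
      by_cases hla : l.1 = a.2
      · rw [hla, Function.update_self]
        exact hb l hl hla
      · rw [Function.update_of_ne hla]
        exact hα l hl fun hl' => hlQ ((List.mem_cons.1 hl').resolve_left hla)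
    obtain ⟨_ | _, x⟩ := a
    · intro b
      by_cases hb : (x, b) ∈ K
      · exact Or.inl ⟨τ, (x, b), hb, rfl⟩
      · refine Or.inr (ih_update ?_)
        rintro l hl rfl rfl
        exact hb hl
    · obtain ⟨o, ho⟩ := exists_matches (τ x)
      have hselect :
          select x o ((fun l => (l, τ)) '' litSet K) = (fun l => (l, τ)) '' litSet K := by
        refine Set.sep_eq_self_iff_mem_true.2 ?_
        rintro _ ⟨l, -, rfl⟩
        exact ho
      refine ⟨o, fun b => hselect.symm ▸ ih_update ?_⟩
      rintro l hl rfl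
      rw [hall l hl List.mem_cons_self] at ho
      rw [ho.eq_of_boolVal]
      exact Bool.not_ne_self l.2

end Entails

/-- What soundness needs to know about a resolution on `x^(τ ∪ ρ b)`, where `S b` is the premise
that contains `x` with sign `b`. -/
structure IsResolvent (P Q : Prefix) (x : ℕ) (τ : Ann) (ρ : Bool → Ann)
    (S : Bool → Set (Lit × Ann)) (E : Set (Lit × Ann)) : Prop where
  binary : τ.Binary
  disjoint : Disjoint (ρ true).dom (ρ false).dom
  embeds : ∀ b, Embeds P Q (ρ !b) (S b \ {((x, b), τ.complete (ρ b))}) E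

namespace IsResolvent

variable {ρ : Bool → Ann} {S : Bool → Set (Lit × Ann)}

theorem mono {R : Prefix} (hR : R ⊆ Q) (h : IsResolvent P Q x τ ρ S E) :
    IsResolvent P R x τ ρ S E :=
  ⟨h.binary, h.disjoint, fun b => (h.embeds b).mono hR⟩

theorem exists_mem (h : IsResolvent P Q x τ ρ S E) {b : Bool} {l : Lit} (hlQ : IsEx Q l.1)
    (hl : ∃ σ, (l, σ) ∈ S b) (hlx : l ≠ (x, b)) : ∃ σ, (l, σ) ∈ E := by
  obtain ⟨σ, hσ⟩ := hl
  exact (h.embeds b _ ⟨hσ, fun he => hlx (congrArg Prod.fst he)⟩ hlQ).imp fun _ h => h.1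

theorem discard (h : IsResolvent P Q x τ ρ S E) (hQ : IsBlock P Q) (hx : x ∉ Q.map Prod.snd)
    (b : Bool) (hS : Entails φ Q α (S b)) : Entails φ Q α E := by
  refine hS.of_embeds hQ fun l hl hlQ => h.embeds b l ⟨hl, ?_⟩ hlQ
  rintro rfl
  exact hx hlQ.mem

theorem entails_of_head_ex {y : ℕ} (h : IsResolvent P ((Quant.ex, y) :: Q) x τ ρ S E)
    (hQ : IsBlock P ((Quant.ex, y) :: Q))
    (ih : ∀ {β}, (∀ b, Entails φ Q β (S b)) → Entails φ Q β E)
    (hS : ∀ b, Entails φ ((Quant.ex, y) :: Q) α (S b)) : Entails φ ((Quant.ex, y) :: Q) α E := by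
  intro c
  by_cases hyx : y = x
  · subst hyx
    refine (hS (!c) c).imp (fun hσ => ?_) ?_
    · exact h.exists_mem List.mem_cons_self hσ fun he => Bool.self_ne_not c (congrArg Prod.snd he)
    · exact (h.mono (List.subset_cons_self _ _)).discard hQ.tail hQ.notMem_tail _
  · by_cases hc : ∃ b σ, ((y, c), σ) ∈ S b
    · obtain ⟨b, hσ⟩ := hc
      exact Or.inl (h.exists_mem List.mem_cons_self hσ fun he => hyx (congrArg Prod.fst he))
    · exact Or.inr (ih fun b => (hS b c).resolve_left fun hb => hc ⟨b, hb⟩)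

/-- A premise whose commitment is not in line with the annotation of its pivot literal entails the
resolvent on its own. -/
theorem entails_of_head_all (h : IsResolvent P ((Quant.all, u) :: Q) x τ ρ S E)
    (hQ : IsBlock P ((Quant.all, u) :: Q))
    (ih : ∀ {β S E}, IsResolvent P Q x τ ρ S E → (∀ b, Entails φ Q β (S b)) → Entails φ Q β E)
    (hS : ∀ b, Entails φ ((Quant.all, u) :: Q) α (S b)) : Entails φ ((Quant.all, u) :: Q) α E := by
  choose o ho using hS
  by_cases hmatch : ∀ b, Matches (o b) (τ.complete (ρ b) u)
  · obtain ⟨o', ho'⟩ := exists_common_commitment h.binary h.disjoint hmatch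
    choose p hp hpo using ho'
    refine ⟨o', fun c => ih (S := fun b => select u (o b) (S b)) ⟨h.binary, h.disjoint, ?_⟩ ?_⟩
    · intro b
      rw [← select_sdiff, ← hpo b]
      exact (h.embeds b).select hQ (hp b)
    · intro b
      rw [← hpo b, getD_or]
      exact ho b _
  · obtain ⟨b, hb⟩ := not_forall.1 hmatch
    refine Entails.of_embeds hQ (h.embeds b) ⟨o b, fun c => ?_⟩
    rw [select_sdiff_of_not_matches hb]
    exact ho b c

theorem entails (h : IsResolvent P Q x τ ρ S E) (hQ : IsBlock P Q)
    (hS : ∀ b, Entails φ Q α (S b)) : Entails φ Q α E := by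
  induction Q generalizing α S E with
  | nil => exact hS true
  | cons a Q ih =>
    obtain ⟨_ | _, y⟩ := a
    · exact h.entails_of_head_ex hQ (ih (h.mono (List.subset_cons_self _ _)) hQ.tail) hS
    · exact h.entails_of_head_all hQ (fun h => ih h hQ.tail) hS

end IsResolvent

/-- The steps of the expansion-based calculi, as far as soundness is concerned. -/
def calculus : Calculus ALit where
  leafRule Q K C := ∃ τ : Ann, (∀ l ∈ K, IsAll Q l.1 → τ l.1 = some (boolVal !l.2)) ∧
    denote C = annotate Q τ K
  unaryRule Q C D := ∃ τ : Ann, Embeds Q Q τ (denote C) (denote D)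
  resRule Q x C D E := ∃ (τ : Ann) (ρ : Bool → Ann),
    IsResolvent Q Q x τ ρ (fun b => cond b (denote C) (denote D)) (denote E)
  shape _ := True

theorem calculus_resRule {S : Bool → List ALit} {E : List ALit} :
    calculus.resRule P x (S true) (S false) E ↔ ∃ (τ : Ann) (ρ : Bool → Ann),
      IsResolvent P P x τ ρ (fun b => denote (S b)) (denote E) := by
  have hS : (fun b => cond b (denote (S true)) (denote (S false))) = fun b => denote (S b) :=
    funext (Bool.forall_bool.2 ⟨rfl, rfl⟩)
  rw [← hS]
  rfl

theorem embeds_annotate {K : List Lit} :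
    Embeds P P (fun _ => none) ((fun l => (l, τ)) '' litSet K) (annotate P τ K) := by
  rintro _ ⟨l, hl, rfl⟩ hlP
  exact ⟨_, ⟨l, ⟨hl, hlP⟩, rfl⟩, fun u hu hidx => Or.inl
    ((if_pos ⟨hu, hidx⟩).trans Option.or_none.symm)⟩

/-- The semantics of `Expansion.calculus` given by `Entails`. -/
def sideSemantics {F : Instance} (hF : F.WellFormed) : SideSemantics calculus F where
  lits C := {l | ∃ σ, (l, σ) ∈ denote C}
  Holds s α C := Entails (F.sideCNF s) (F.sidePrefix s) α (denote C)
  leaf_lits h l hl hlp := by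
    obtain ⟨τ, -, hC⟩ := h
    refine ⟨Ann.permitted F.pre l.1 τ, ?_⟩
    rw [hC]
    exact ⟨l, ⟨hl, Instance.isEx_of_mem_p hlp⟩, rfl⟩
  leaf {s α K C} hK h hα := by
    obtain ⟨τ, hall, hC⟩ := h
    have hQ := hF.isBlock s
    rw [hC]
    refine .of_embeds hQ (embeds_annotate.mono hQ.sublist.subset)
      (.of_mem hK (fun l hl hlQ => hall l hl (hQ.isAll hlQ)) fun l hl hlQ => ?_)
    exact hα l hl ((hF.mem_p_or_mem_side hK hl).resolve_right hlQ)
  unary_lits h l hl hlp := by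
    obtain ⟨τ, h⟩ := h
    obtain ⟨σ, hσ⟩ := hl
    exact (h _ hσ (Instance.isEx_of_mem_p hlp)).imp fun _ h => h.1
  unary {s _ _ _} h hα := by
    obtain ⟨τ, h⟩ := h
    exact hα.of_embeds (hF.isBlock s) (h.mono (hF.isBlock s).sublist.subset)
  res_lits h b l hl hlp hlx := by
    obtain ⟨τ, ρ, h⟩ := calculus_resRule.1 h
    exact h.exists_mem (Instance.isEx_of_mem_p hlp) hl hlx
  res_discard {s _ _ _ _} h hx b hα := by
    obtain ⟨τ, ρ, h⟩ := calculus_resRule.1 h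
    exact (h.mono (hF.isBlock s).sublist.subset).discard (hF.isBlock s) hx b hα
  res {s _ _ _ _} h hα := by
    obtain ⟨τ, ρ, h⟩ := calculus_resRule.1 h
    exact (h.mono (hF.isBlock s).sublist.subset).entails (hF.isBlock s) hα
  lits_nil := by simp [denote, litSet]
  not_qTrue h := Entails.not_qTrue (by simpa [denote, litSet] using h)

theorem interpolates_calculus : Interpolates calculus :=
  .of_sideSemantics fun _ hF => ⟨sideSemantics hF⟩

section Rules

variable {K : List Lit} {C D E : List ALit}

theorem Leaf.calculus_leafRule (h : Leaf P K C) : calculus.leafRule P K C := by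
  obtain ⟨τ, hτ, hC⟩ := h
  refine ⟨τ, ?_, hC⟩
  rintro ⟨u, _ | _⟩ hl hu
  · exact (hτ u).2.1.2 ⟨hu, hl⟩
  · exact (hτ u).1.2 ⟨hu, hl⟩

theorem LeafComplete.calculus_leafRule (h : LeafComplete P K C) : calculus.leafRule P K C := by
  obtain ⟨τ, -, -, h0, h1, hC⟩ := h
  refine ⟨τ, ?_, hC⟩
  rintro ⟨u, _ | _⟩ hl hu
  · exact h1 u hu hl
  · exact h0 u hu hl

theorem Instantiation.calculus_unaryRule (h : Instantiation P (denote C) (denote D)) :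
    calculus.unaryRule P C D := by
  obtain ⟨τ, -, -, hD⟩ := h
  exact ⟨τ, .of_inst hD.ge⟩

theorem MRes.calculus_resRule (h : MRes P x (denote C) (denote D) (denote E)) :
    calculus.resRule P x C D E := by
  obtain ⟨τ, ξ, σ, -, -, hξσ, hτ, -, -, hE⟩ := h
  exact ⟨τ, fun b => cond b ξ σ, hτ, hξσ, Bool.forall_bool.2
    ⟨.of_inst (hE ▸ Set.subset_union_right), .of_inst (hE ▸ Set.subset_union_left)⟩⟩

/-- All annotations in `C` have values in `{0, 1}`. -/
def BinaryClause (C : Set (Lit × Ann)) : Prop := ∀ l ∈ C, l.2.Binary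

theorem Res.calculus_resRule (h : Res x (denote C) (denote D) (denote E))
    (hC : BinaryClause (denote C)) : calculus.resRule P x C D E := by
  obtain ⟨τ, hx, -, hE⟩ := h
  have hτ : τ.complete (fun _ => none) = τ := funext fun _ => Option.or_none
  refine ⟨τ, fun _ _ => none, hC _ hx, by simp [Ann.dom], Bool.forall_bool.2 ⟨?_, ?_⟩⟩
  · exact hτ.symm ▸ .of_subset (hE ▸ Set.subset_union_right)
  · exact hτ.symm ▸ .of_subset (hE ▸ Set.subset_union_left)

end Rules

theorem binary_permitted (hτ : τ.Binary) : (Ann.permitted P x τ).Binary := by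
  intro u
  unfold Ann.permitted
  split
  · exact hτ u
  · exact nofun

theorem binaryClause_annotate {K : List Lit} (hτ : τ.Binary) : BinaryClause (annotate P τ K) := by
  rintro _ ⟨l, -, rfl⟩
  exact binary_permitted hτ

theorem Leaf.binaryClause {K : List Lit} {C : List ALit} (h : Leaf P K C) :
    BinaryClause (denote C) := by
  obtain ⟨τ, hτ, hC⟩ := h
  exact hC ▸ binaryClause_annotate fun u => (hτ u).2.2

theorem LeafComplete.binaryClause {K : List Lit} {C : List ALit} (h : LeafComplete P K C) :
    BinaryClause (denote C) := by
  obtain ⟨τ, hτ, -, -, -, hC⟩ := h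
  exact hC ▸ binaryClause_annotate hτ

theorem Instantiation.binaryClause (h : Instantiation P C D) (hC : BinaryClause C) :
    BinaryClause D := by
  obtain ⟨τ, hτ, -, rfl⟩ := h
  rintro _ ⟨l, hl, rfl⟩
  refine binary_permitted fun u hu => ?_
  obtain hu | ⟨-, hu⟩ := Option.or_eq_some_iff.1 hu
  · exact hC l hl u hu
  · exact hτ u hu

theorem Res.binaryClause (h : Res x C D E) (hC : BinaryClause C) (hD : BinaryClause D) :
    BinaryClause E := by
  obtain ⟨τ, -, -, rfl⟩ := h
  rintro l (hl | hl)
  · exact hC l hl.1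
  · exact hD l hl.1

end Expansion

theorem interpolates_irmCalc : Interpolates irmCalc :=
  Expansion.interpolates_calculus.of_le (fun _ => True) (fun _ h => h)
    (fun _ h => ⟨Expansion.Leaf.calculus_leafRule h, trivial⟩)
    (fun _ h => ⟨h.elim (·.calculus_unaryRule) fun h => ⟨_, h.embeds⟩, trivial⟩)
    fun _ _ h => ⟨h.calculus_resRule, trivial⟩

theorem interpolates_irCalc : Interpolates irCalc :=
  Expansion.interpolates_calculus.of_le (fun C => Expansion.BinaryClause (denote C))
    (fun _ h => h)
    (fun _ h => ⟨Expansion.Leaf.calculus_leafRule h, Expansion.Leaf.binaryClause h⟩)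
    (fun hC h => ⟨h.calculus_unaryRule, h.binaryClause hC⟩)
    fun hC hD h => ⟨h.calculus_resRule hC, h.binaryClause hC hD⟩

theorem interpolates_forallExpRes : Interpolates forallExpRes :=
  Expansion.interpolates_calculus.of_le (fun C => Expansion.BinaryClause (denote C))
    (fun _ h => h)
    (fun _ h => ⟨Expansion.LeafComplete.calculus_leafRule h,
      Expansion.LeafComplete.binaryClause h⟩)
    (fun _ h => h.elim) fun hC hD h => ⟨h.calculus_resRule hC, h.binaryClause hC hD⟩

/-! ### Circuits along a proof -/

theorem Gate.eval_congr {α : ℕ → Bool} {vs ws : List Bool} {g : Gate}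
    (h : ∀ j ∈ g.args, vs.getD j false = ws.getD j false) : g.eval α vs = g.eval α ws := by
  cases g <;> simp only [Gate.args, List.mem_cons, List.not_mem_nil, or_false, forall_eq_or_imp,
    forall_eq] at h <;> simp only [Gate.eval, h]

namespace Circuit

variable {α : ℕ → Bool} {G : Circuit} {g : Gate} {i : ℕ}

theorem values_concat (α : ℕ → Bool) (G : Circuit) (g : Gate) :
    values α (G ++ [g]) = values α G ++ [g.eval α (values α G)] := by
  simp [values, List.foldl_append]

theorem length_values (α : ℕ → Bool) (G : Circuit) : (values α G).length = G.length := by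
  induction G using List.reverseRecOn with
  | nil => rfl
  | append_singleton G g ih => simp [values_concat, ih]

theorem getD_values_concat_of_lt (hi : i < G.length) :
    (values α (G ++ [g])).getD i false = (values α G).getD i false := by
  rw [values_concat, List.getD_append _ _ _ _ (by rwa [length_values])]

theorem getD_values_concat_length :
    (values α (G ++ [g])).getD G.length false = g.eval α (values α G) := by
  rw [values_concat, List.getD_append_right _ _ _ _ (length_values α G).le, length_values,
    Nat.sub_self, List.getD_cons_zero]

theorem getD_values (hG : ∀ i g, G[i]? = some g → ∀ j ∈ Gate.args g, j < i) (α : ℕ → Bool)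
    (hi : G[i]? = some g) : (values α G).getD i false = g.eval α (values α G) := by
  induction G using List.reverseRecOn generalizing i g with
  | nil => exact absurd hi (by simp)
  | append_singleton G last ih =>
    have hlt : i < G.length + 1 := by simpa using (List.getElem?_eq_some_iff.1 hi).1
    have heval : g.eval α (values α (G ++ [last])) = g.eval α (values α G) :=
      Gate.eval_congr fun j hj =>
        getD_values_concat_of_lt ((hG i g hi j hj).trans_le (Nat.lt_succ_iff.1 hlt))
    rw [heval]
    obtain hiG | rfl := Nat.lt_succ_iff_lt_or_eq.1 hlt
    · rw [List.getElem?_append_left hiG] at hi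
      rw [getD_values_concat_of_lt hiG]
      refine ih (fun i g h => hG i g ?_) hi
      rw [List.getElem?_append_left (List.getElem?_eq_some_iff.1 h).1, h]
    · rw [List.getElem?_concat_length, Option.some_inj] at hi
      rw [getD_values_concat_length, hi]

theorem eval_eq_getD (G : Circuit) (α : ℕ → Bool) :
    G.eval α = (values α G).getD (G.length - 1) false := by
  rw [eval, List.getLastD_eq_getLast?, List.getLast?_eq_getElem?, length_values,
    List.getD_eq_getElem?_getD]

end Circuit

/-- A scheme for the gates of a block of a circuit, used where the pivot `x` of a resolution step
lies in `p`: `G b r x g h` is the gate at offset `r` of the block starting at position `b`, where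
`g` and `h` are the positions of the gates of the two premises. -/
abbrev Gadget := (b r x g h : ℕ) → Gate

/-- The gate at offset `k` of the gadget `G` has the value of a line obtained by resolution on a
variable of `p`, in the monotone version if `mono`. -/
structure Gadget.Computes (G : Gadget) (k : ℕ) (mono : Bool) : Prop where
  inputs {b r x g h : ℕ} : ∀ y ∈ (G b r x g h).inputs, y = x
  args_lt {b r x g h : ℕ} (hg : g < b) (hh : h < b) : ∀ j ∈ (G b r x g h).args, j < b + r
  eval {α : ℕ → Bool} {vs : List Bool} {b x g h : ℕ}
    (hvs : ∀ r ≤ k, vs.getD (b + r) false = (G b r x g h).eval α vs) :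
    vs.getD (b + k) false =
      if mono then (α x || vs.getD g false) && vs.getD h false
      else if α x then vs.getD h false else vs.getD g false

/-- The position of the last gate of the `i`-th block in a sequence of blocks of `k + 1` gates. -/
def blockEnd (k i : ℕ) : ℕ := (k + 1) * i + k

/-- The gate at offset `r` in the block for line `i`, obtained from `s`, of the circuit of a proof
with blocks of `k + 1` gates. Where no gadget is needed, all gates of the block are the same. -/
def lineGate (F : Instance) (k : ℕ) (G : Gadget) (i r : ℕ) : Source → Gate
  | Source.leaf c => Gate.const (decide (F.A.length ≤ c))
  | Source.unary j => Gate.and (blockEnd k j) (blockEnd k j)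
  | Source.res j l x =>
      if x ∈ F.p then G ((k + 1) * i) r x (blockEnd k j) (blockEnd k l)
      else if x ∈ F.q.map Prod.snd then Gate.or (blockEnd k j) (blockEnd k l)
      else Gate.and (blockEnd k j) (blockEnd k l)

/-- The origin of line `i` of `π`; beyond the end of `π` the value is irrelevant. -/
def ProofGraph.source {Λ : Type} (π : ProofGraph Λ) (i : ℕ) : Source :=
  (π[i]?.map Prod.snd).getD (Source.leaf 0)

/-- The circuit of a proof: the last gate of the `i`-th block of `k + 1` gates has the value of the
`i`-th line. -/
def lineCircuit {Λ : Type} (k : ℕ) (G : Gadget) (F : Instance) (π : ProofGraph Λ) : Circuit :=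
  (List.range ((k + 1) * π.length)).map fun m =>
    lineGate F k G (m / (k + 1)) (m % (k + 1)) (π.source (m / (k + 1)))

theorem Calculus.StepOK.premises_lt {Λ : Type} {S : Calculus Λ} {Q : Prefix} {φ : CNF}
    {π : ProofGraph Λ} {i : ℕ} {C : List Λ} {s : Source} (h : S.StepOK Q φ π i C s) :
    ∀ j ∈ s.premises, j < i := by
  cases s with
  | leaf k => simp [Source.premises]
  | unary j => simpa [Source.premises] using h.1
  | res j k x => simpa [Source.premises] using ⟨h.1, h.2.1⟩

theorem Calculus.Refutes.length_pos {Λ : Type} {S : Calculus Λ} {Q : Prefix} {φ : CNF}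
    {π : ProofGraph Λ} (h : S.Refutes Q φ π) : 0 < π.length := by
  obtain ⟨-, ⟨s, hs⟩, -⟩ := h
  exact List.length_pos_of_mem (List.mem_of_getLast? hs)

section LineGate

variable {F : Instance} {k i r : ℕ} {G : Gadget} {s : Source}

theorem blockEnd_lt (h : i < r) : blockEnd k i < (k + 1) * r := by
  have := Nat.mul_le_mul_left (k + 1) (Nat.succ_le_of_lt h)
  rw [Nat.mul_succ] at this
  unfold blockEnd
  omega

theorem lineGate_cases {P : Gate → Prop} (const : ∀ b, P (.const b)) (and : ∀ g h, P (.and g h))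
    (or : ∀ g h, P (.or g h)) (gadget : ∀ b x g h, x ∈ F.p → P (G b r x g h)) :
    P (lineGate F k G i r s) := by
  cases s with
  | leaf c => exact const _
  | unary j => exact and _ _
  | res j l x =>
    simp only [lineGate]
    split_ifs with hp hq
    exacts [gadget _ _ _ _ hp, or _ _, and _ _]

theorem args_lineGate_lt {mono : Bool} (hG : G.Computes k mono) (hs : ∀ j ∈ s.premises, j < i) :
    ∀ j ∈ (lineGate F k G i r s).args, j < (k + 1) * i + r := by
  have hlt (j : ℕ) (hj : j < i) : blockEnd k j < (k + 1) * i + r :=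
    (blockEnd_lt hj).trans_le (Nat.le_add_right _ _)
  cases s with
  | leaf c => simp [lineGate, Gate.args]
  | unary j => simpa [lineGate, Gate.args] using hlt j (hs j (by simp [Source.premises]))
  | res j l x =>
    have hj : j < i := hs j (by simp [Source.premises])
    have hl : l < i := hs l (by simp [Source.premises])
    simp only [lineGate]
    split_ifs
    · exact hG.args_lt (blockEnd_lt hj) (blockEnd_lt hl)
    · simpa [Gate.args] using ⟨hlt j hj, hlt l hl⟩
    · simpa [Gate.args] using ⟨hlt j hj, hlt l hl⟩

theorem lineValue_of_lineGate {mono : Bool} (hG : G.Computes k mono) {α : ℕ → Bool}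
    {vs : List Bool} (h : ∀ r ≤ k,
      vs.getD ((k + 1) * i + r) false = (lineGate F k G i r s).eval α vs) :
    vs.getD (blockEnd k i) false =
      lineValue F mono α (fun j => vs.getD (blockEnd k j) false) s := by
  cases s with
  | leaf c => exact h k le_rfl
  | unary j => exact (h k le_rfl).trans (Bool.and_self _)
  | res j l x =>
    simp only [lineGate, lineValue] at h ⊢
    by_cases hp : x ∈ F.p
    · simp only [if_pos hp] at h ⊢
      exact hG.eval h
    · simp only [if_neg hp] at h ⊢
      split_ifs at h ⊢ <;> exact h k le_rfl

end LineGate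

section LineCircuit

variable {Λ : Type} {S : Calculus Λ} {F : Instance} {π : ProofGraph Λ} {k : ℕ} {G : Gadget}

theorem length_lineCircuit : (lineCircuit k G F π).length = (k + 1) * π.length := by
  simp [lineCircuit]

theorem lineCircuit_cases {P : Gate → Prop} (const : ∀ b, P (.const b))
    (and : ∀ g h, P (.and g h)) (or : ∀ g h, P (.or g h))
    (gadget : ∀ b r x g h, x ∈ F.p → P (G b r x g h)) : ∀ g ∈ lineCircuit k G F π, P g := by
  intro g hg
  obtain ⟨m, -, rfl⟩ := List.mem_map.1 hg
  exact lineGate_cases const and or fun b x g h => gadget b _ x g h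

theorem lineCircuit_getElem? {i r : ℕ} {C : List Λ} {s : Source} (hi : π[i]? = some (C, s))
    (hr : r ≤ k) : (lineCircuit k G F π)[(k + 1) * i + r]? = some (lineGate F k G i r s) := by
  have hlt : (k + 1) * i + r < (k + 1) * π.length :=
    (Nat.add_le_add_left hr _).trans_lt (blockEnd_lt (List.getElem?_eq_some_iff.1 hi).1)
  have hdiv : ((k + 1) * i + r) / (k + 1) = i := by
    rw [Nat.mul_add_div k.succ_pos, Nat.div_eq_of_lt (Nat.lt_succ_of_le hr), add_zero]
  have hmod : ((k + 1) * i + r) % (k + 1) = r := by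
    rw [Nat.mul_add_mod, Nat.mod_eq_of_lt (Nat.lt_succ_of_le hr)]
  rw [lineCircuit, List.getElem?_map, List.getElem?_range hlt, Option.map_some, hdiv, hmod,
    ProofGraph.source, hi, Option.map_some, Option.getD_some]

theorem lineCircuit_args_lt {mono : Bool} (hG : G.Computes k mono)
    (hπ : S.Refutes F.pre F.matrix π) :
    ∀ m g, (lineCircuit k G F π)[m]? = some g → ∀ j ∈ Gate.args g, j < m := by
  intro m g hm
  have hline : m / (k + 1) < π.length :=
    Nat.div_lt_of_lt_mul (length_lineCircuit ▸ (List.getElem?_eq_some_iff.1 hm).1)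
  obtain ⟨C, s, hi⟩ : ∃ C s, π[m / (k + 1)]? = some (C, s) :=
    ⟨_, _, List.getElem?_eq_getElem hline⟩
  have hgate := lineCircuit_getElem? (G := G) (F := F) hi
    (Nat.lt_succ_iff.1 (Nat.mod_lt m k.succ_pos))
  have hargs := args_lineGate_lt (F := F) (r := m % (k + 1)) hG (hπ.1 _ _ _ hi).premises_lt
  rw [Nat.div_add_mod] at hgate hargs
  obtain rfl := Option.some_inj.1 (hm.symm.trans hgate)
  exact hargs

theorem lineCircuit_interpolates (hS : Interpolates S) (hF : F.WellFormed)
    (hπ : S.Refutes F.pre F.matrix π) {mono : Bool} (hmono : mono = true → F.PositiveInA)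
    (hG : G.Computes k mono) : IsInterpolationCircuit F (lineCircuit k G F π) := by
  have hargs := lineCircuit_args_lt hG hπ
  have hpos := hπ.length_pos
  refine ⟨⟨List.ne_nil_of_length_pos ?_, hargs⟩, ?_, fun α => ?_⟩
  · rw [length_lineCircuit]
    positivity
  · refine lineCircuit_cases (P := fun g => ∀ x ∈ g.inputs, x ∈ F.p) (by simp [Gate.inputs])
      (by simp [Gate.inputs]) (by simp [Gate.inputs]) fun b r x g h hx y hy => ?_
    exact hG.inputs y hy ▸ hx
  · have key := hS F π hF hπ mono α
      (fun i => (Circuit.values α (lineCircuit k G F π)).getD (blockEnd k i) false) hmono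
      fun i C s hi => lineValue_of_lineGate hG fun r hr =>
        Circuit.getD_values hargs α (lineCircuit_getElem? hi hr)
    have houtput : (k + 1) * π.length - 1 = blockEnd k (π.length - 1) := by
      obtain ⟨n, hn⟩ := Nat.exists_eq_add_one.2 hpos
      rw [hn, Nat.mul_succ, blockEnd]
      rfl
    rw [Circuit.eval_eq_getD, length_lineCircuit, houtput]
    constructor <;> intro hv <;> rw [hv] at key <;> exact key

end LineCircuit

/-- A single selector gate. -/
def selGadget : Gadget := fun _ _ x g h => Gate.sel x g h

/-- The monotone replacement of a selector gate. -/
def orAndGadget : Gadget := fun _ _ x g h => Gate.orAnd x g h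

/-- A gadget over the usual basis, for `(x ∨ g) ∧ h` if `mono` and for
`(¬ x ∧ g) ∨ (x ∧ h)` otherwise. -/
def standardGadget (mono : Bool) : Gadget := fun b r x g h =>
  match mono, r with
  | _, 0 => Gate.input x
  | true, 1 => Gate.or b g
  | true, _ => Gate.and (b + 1) h
  | false, 1 => Gate.not b
  | false, 2 => Gate.and (b + 1) g
  | false, 3 => Gate.and b h
  | false, _ => Gate.or (b + 2) (b + 3)

theorem selGadget_computes : selGadget.Computes 0 false where
  inputs := by simp [selGadget, Gate.inputs]
  args_lt hg hh := by
    simpa [selGadget, Gate.args] using ⟨Nat.lt_add_right _ hg, Nat.lt_add_right _ hh⟩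
  eval hvs := by simpa [selGadget, Gate.eval] using hvs 0 le_rfl

theorem orAndGadget_computes : orAndGadget.Computes 0 true where
  inputs := by simp [orAndGadget, Gate.inputs]
  args_lt hg hh := by
    simpa [orAndGadget, Gate.args] using ⟨Nat.lt_add_right _ hg, Nat.lt_add_right _ hh⟩
  eval hvs := by simpa [orAndGadget, Gate.eval] using hvs 0 le_rfl

theorem standardGadget_computes (mono : Bool) : (standardGadget mono).Computes 4 mono where
  inputs {b r x g h} := by
    cases mono <;> rcases r with _ | _ | _ | _ | _ <;> simp [standardGadget, Gate.inputs]
  args_lt {b r x g h} hg hh := by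
    cases mono <;> rcases r with _ | _ | _ | _ | _ <;> simp [standardGadget, Gate.args] <;> omega
  eval {α vs b x g h} hvs := by
    have h0 := hvs 0 (by norm_num)
    have h1 := hvs 1 (by norm_num)
    have h2 := hvs 2 (by norm_num)
    have h3 := hvs 3 (by norm_num)
    have h4 := hvs 4 (by norm_num)
    cases mono
    · simp only [standardGadget, Gate.eval] at h0 h1 h2 h3 h4
      rw [add_zero] at h0
      rw [h4, h2, h3, h1, h0]
      cases α x <;> simp
    · simp only [standardGadget, Gate.eval] at h0 h1 h4
      rw [add_zero] at h0
      rw [h4, h1, h0]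
      rfl

theorem standardGadget_isStandard {mono : Bool} {b r x g h : ℕ} :
    (standardGadget mono b r x g h).IsStandard := by
  cases mono <;> rcases r with _ | _ | _ | _ | _ <;> trivial

theorem standardGadget_isMonotone {b r x g h : ℕ} :
    (standardGadget true b r x g h).IsMonotone := by
  rcases r with _ | _ | _ | _ | _ <;> trivial

theorem replaceSel_lineCircuit_selGadget {Λ : Type} {k : ℕ} {F : Instance} {π : ProofGraph Λ} :
    (lineCircuit k selGadget F π).replaceSel = lineCircuit k orAndGadget F π := by
  simp only [Circuit.replaceSel, lineCircuit, List.map_map]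
  refine List.map_congr_left fun m _ => ?_
  cases h : π.source (m / (k + 1)) with
  | leaf c => simp [h, lineGate, Gate.replaceSel]
  | unary j => simp [h, lineGate, Gate.replaceSel]
  | res j l x =>
    simp only [Function.comp_apply, h, lineGate]
    split_ifs <;> rfl

/-! ### Effectiveness -/

namespace Effective

variable {α β : Type*} [Primcodable α] [Primcodable β]

theorem primrec_instanceEquiv : Primrec instanceEquiv := .of_equiv

theorem primrec_p : Primrec Instance.p := Primrec.fst.comp primrec_instanceEquiv

theorem primrec_q : Primrec Instance.q :=
  Primrec.fst.comp (Primrec.snd.comp primrec_instanceEquiv)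

theorem primrec_A : Primrec Instance.A :=
  Primrec.fst.comp (Primrec.snd.comp (Primrec.snd.comp (Primrec.snd.comp primrec_instanceEquiv)))

theorem primrec_qVars : Primrec fun F : Instance => F.q.map Prod.snd :=
  Primrec.list_map primrec_q (Primrec.snd.comp Primrec.snd).to₂

theorem primrec_source_casesOn {s : α → Source} {f g : α → ℕ → β} {h : α → ℕ × ℕ × ℕ → β}
    (hs : Primrec s) (hf : Primrec₂ f) (hg : Primrec₂ g) (hh : Primrec₂ h) :
    Primrec fun a => (Source.casesOn (s a) (f a) (g a) fun i j x => h a (i, j, x) : β) := by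
  have hgh : Primrec₂ fun (a : α) (t : ℕ ⊕ ℕ × ℕ × ℕ) => (Sum.casesOn t (g a) (h a) : β) :=
    Primrec.sumCasesOn Primrec.snd
      (hg.comp (Primrec.fst.comp Primrec.fst) Primrec.snd).to₂
      (hh.comp (Primrec.fst.comp Primrec.fst) Primrec.snd).to₂
  refine (Primrec.sumCasesOn ((Primrec.of_equiv (e := sourceEquiv)).comp hs) hf hgh).of_eq
    fun a => ?_
  cases s a <;> rfl

section Gates

variable {f g h : α → ℕ}

theorem primrec_gate {f : α → Bool ⊕ ℕ ⊕ ℕ ⊕ (ℕ × ℕ) ⊕ (ℕ × ℕ) ⊕ (ℕ × ℕ × ℕ) ⊕ (ℕ × ℕ × ℕ)}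
    (hf : Primrec f) : Primrec fun a => gateEquiv.symm (f a) :=
  (Primrec.of_equiv_symm (e := gateEquiv)).comp hf

theorem primrec_const {b : α → Bool} (hb : Primrec b) : Primrec fun a => Gate.const (b a) :=
  primrec_gate (Primrec.sumInl.comp hb)

theorem primrec_input (hf : Primrec f) : Primrec fun a => Gate.input (f a) :=
  primrec_gate (Primrec.sumInr.comp (Primrec.sumInl.comp hf))

theorem primrec_not (hf : Primrec f) : Primrec fun a => Gate.not (f a) :=
  primrec_gate (Primrec.sumInr.comp (Primrec.sumInr.comp (Primrec.sumInl.comp hf)))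

theorem primrec_and (hf : Primrec f) (hg : Primrec g) : Primrec fun a => Gate.and (f a) (g a) :=
  primrec_gate (Primrec.sumInr.comp (Primrec.sumInr.comp (Primrec.sumInr.comp
    (Primrec.sumInl.comp (hf.pair hg)))))

theorem primrec_or (hf : Primrec f) (hg : Primrec g) : Primrec fun a => Gate.or (f a) (g a) :=
  primrec_gate (Primrec.sumInr.comp (Primrec.sumInr.comp (Primrec.sumInr.comp
    (Primrec.sumInr.comp (Primrec.sumInl.comp (hf.pair hg))))))

theorem primrec_sel (hf : Primrec f) (hg : Primrec g) (hh : Primrec h) :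
    Primrec fun a => Gate.sel (f a) (g a) (h a) :=
  primrec_gate (Primrec.sumInr.comp (Primrec.sumInr.comp (Primrec.sumInr.comp
    (Primrec.sumInr.comp (Primrec.sumInr.comp (Primrec.sumInl.comp (hf.pair (hg.pair hh))))))))

end Gates

theorem primrecPred_mem {x : α → β} {l : α → List β} (hx : Primrec x) (hl : Primrec l) :
    PrimrecPred fun a => x a ∈ l a :=
  (PrimrecRel.comp (PrimrecRel.exists_mem_list Primrec.eq) hl hx).of_eq fun a => by
    rw [exists_eq_right]

theorem primrecPred_positiveInA : PrimrecPred Instance.PositiveInA := by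
  have hC : PrimrecRel fun (x : ℕ) (C : List Lit) => (x, false) ∉ C :=
    (primrecPred_mem (x := fun t : ℕ × List Lit => (t.1, false)) (l := Prod.snd)
      (Primrec.fst.pair (Primrec.const false)) Primrec.snd).not
  have hp : PrimrecRel fun (C : List Lit) (p : List ℕ) => ∀ x ∈ p, (x, false) ∉ C :=
    (PrimrecRel.forall_mem_list hC).swap
  exact (PrimrecRel.forall_mem_list hp).comp primrec_A primrec_p

/-- Gadgets that depend on the instance and are computed primitive recursively from it. -/
def PrimrecGadget (G : Instance → Gadget) : Prop :=
  Primrec fun t : Instance × ℕ × ℕ × ℕ × ℕ × ℕ =>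
    G t.1 t.2.1 t.2.2.1 t.2.2.2.1 t.2.2.2.2.1 t.2.2.2.2.2

theorem PrimrecGadget.comp {G : Instance → Gadget} (hG : PrimrecGadget G) {F : α → Instance}
    {b r x g h : α → ℕ} (hF : Primrec F) (hb : Primrec b) (hr : Primrec r) (hx : Primrec x)
    (hg : Primrec g) (hh : Primrec h) :
    Primrec fun a => G (F a) (b a) (r a) (x a) (g a) (h a) :=
  Primrec.comp hG (hF.pair (hb.pair (hr.pair (hx.pair (hg.pair hh)))))

theorem PrimrecGadget.of_comp {G : Instance → Gadget}
    (hG : ∀ {F : Instance × ℕ × ℕ × ℕ × ℕ × ℕ → Instance} {b r x g h : _ → ℕ}, Primrec F →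
      Primrec b → Primrec r → Primrec x → Primrec g → Primrec h →
      Primrec fun a => G (F a) (b a) (r a) (x a) (g a) (h a)) : PrimrecGadget G :=
  have tail : Primrec fun t : Instance × ℕ × ℕ × ℕ × ℕ × ℕ => t.2.2.2 :=
    Primrec.snd.comp (Primrec.snd.comp Primrec.snd)
  hG Primrec.fst (Primrec.fst.comp Primrec.snd) (Primrec.fst.comp (Primrec.snd.comp Primrec.snd))
    (Primrec.fst.comp tail) (Primrec.fst.comp (Primrec.snd.comp tail))
    (Primrec.snd.comp (Primrec.snd.comp tail))

theorem primrec_selGadget : PrimrecGadget fun _ => selGadget :=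
  .of_comp fun _ _ _ hx hg hh => primrec_sel hx hg hh

theorem primrec_standardGadget {mono : α → Bool} {b r x g h : α → ℕ} (hm : Primrec mono)
    (hb : Primrec b) (hr : Primrec r) (hx : Primrec x) (hg : Primrec g) (hh : Primrec h) :
    Primrec fun a => standardGadget (mono a) (b a) (r a) (x a) (g a) (h a) := by
  have offset (n : ℕ) : Primrec fun a => b a + n := Primrec.nat_add.comp hb (Primrec.const n)
  have offset_eq (n : ℕ) : PrimrecPred fun a => r a = n := Primrec.eq.comp hr (Primrec.const n)
  refine (Primrec.ite (offset_eq 0) (primrec_input hx) (Primrec.cond hm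
    (Primrec.ite (offset_eq 1) (primrec_or hb hg) (primrec_and (offset 1) hh))
    (Primrec.ite (offset_eq 1) (primrec_not hb) (Primrec.ite (offset_eq 2)
      (primrec_and (offset 1) hg) (Primrec.ite (offset_eq 3) (primrec_and hb hh)
        (primrec_or (offset 2) (offset 3))))))).of_eq fun a => ?_
  cases mono a <;> rcases r a with _ | _ | _ | _ | _ <;> rfl

theorem primrec_blockEnd (k : ℕ) : Primrec (blockEnd k) :=
  Primrec.nat_add.comp (Primrec.nat_mul.comp (Primrec.const (k + 1)) Primrec.id) (Primrec.const k)

theorem primrec_lineGate {G : Instance → Gadget} (hG : PrimrecGadget G) (k : ℕ)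
    {F : α → Instance} {i r : α → ℕ} {s : α → Source} (hF : Primrec F) (hi : Primrec i)
    (hr : Primrec r) (hs : Primrec s) :
    Primrec fun a => lineGate (F a) k (G (F a)) (i a) (r a) (s a) := by
  have hpos : Primrec fun a => (k + 1) * i a := Primrec.nat_mul.comp (Primrec.const _) hi
  have hj : Primrec fun t : α × ℕ × ℕ × ℕ => blockEnd k t.2.1 :=
    (primrec_blockEnd k).comp (Primrec.fst.comp Primrec.snd)
  have hl : Primrec fun t : α × ℕ × ℕ × ℕ => blockEnd k t.2.2.1 :=
    (primrec_blockEnd k).comp (Primrec.fst.comp (Primrec.snd.comp Primrec.snd))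
  have hx : Primrec fun t : α × ℕ × ℕ × ℕ => t.2.2.2 :=
    Primrec.snd.comp (Primrec.snd.comp Primrec.snd)
  have hF' {γ : Type} [Primcodable γ] : Primrec fun t : α × γ => F t.1 := hF.comp Primrec.fst
  have hend : Primrec fun t : α × ℕ => blockEnd k t.2 := (primrec_blockEnd k).comp Primrec.snd
  have hleaf : Primrec₂ fun (a : α) c => Gate.const (decide ((F a).A.length ≤ c)) :=
    primrec_const (PrimrecPred.decide (Primrec.nat_le.comp
      (Primrec.list_length.comp (primrec_A.comp hF')) Primrec.snd))
  have hres : Primrec₂ fun (a : α) (t : ℕ × ℕ × ℕ) =>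
      lineGate (F a) k (G (F a)) (i a) (r a) (.res t.1 t.2.1 t.2.2) :=
    Primrec.ite (primrecPred_mem hx (primrec_p.comp hF'))
      (hG.comp hF' (hpos.comp Primrec.fst) (hr.comp Primrec.fst) hx hj hl)
      (Primrec.ite (primrecPred_mem hx (primrec_qVars.comp hF')) (primrec_or hj hl)
        (primrec_and hj hl))
  refine (primrec_source_casesOn hs hleaf (primrec_and hend hend).to₂ hres).of_eq fun a => ?_
  cases s a <;> rfl

theorem primrec_source {Λ : Type} [Primcodable Λ] : Primrec₂ (ProofGraph.source (Λ := Λ)) :=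
  Primrec.option_getD.comp (Primrec.option_map Primrec.list_getElem?
    (Primrec.snd.comp Primrec.snd).to₂) (Primrec.const _)

theorem primrec_lineCircuit {Λ : Type} [Primcodable Λ] {G : Instance → Gadget}
    (hG : PrimrecGadget G) (k : ℕ) :
    Primrec fun t : Instance × ProofGraph Λ => lineCircuit k (G t.1) t.1 t.2 := by
  have hline : Primrec fun t : (Instance × ProofGraph Λ) × ℕ => t.2 / (k + 1) :=
    Primrec.nat_div.comp Primrec.snd (Primrec.const _)
  exact Primrec.list_map
    (Primrec.list_range.comp (Primrec.nat_mul.comp (Primrec.const _)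
      (Primrec.list_length.comp Primrec.snd)))
    (primrec_lineGate hG k (Primrec.fst.comp Primrec.fst) hline
      (Primrec.nat_mod.comp Primrec.snd (Primrec.const _))
      (primrec_source.comp (Primrec.snd.comp Primrec.fst) hline)).to₂

end Effective

section Extraction

variable {Λ : Type} [Primcodable Λ] {S : Calculus Λ}

theorem Interpolates.hasMonotoneFeasibleInterpolation (hS : Interpolates S) :
    HasMonotoneFeasibleInterpolation S := by
  classical
  have hG : Effective.PrimrecGadget fun F => standardGadget (decide F.PositiveInA) :=
    .of_comp fun hF => Effective.primrec_standardGadget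
      (Effective.primrecPred_positiveInA.decide.comp hF)
  refine ⟨fun t => lineCircuit 4 (standardGadget (decide t.1.PositiveInA)) t.1 t.2,
    (Effective.primrec_lineCircuit hG 4).to_comp, 5 * Polynomial.X, fun F π hF hπ =>
      ⟨lineCircuit_interpolates hS hF hπ of_decide_eq_true (standardGadget_computes _),
        ?_, ?_, fun hpos => ?_⟩⟩
  · exact lineCircuit_cases (fun _ => trivial) (fun _ _ => trivial) (fun _ _ => trivial)
      fun _ _ _ _ _ _ => standardGadget_isStandard
  · simp [length_lineCircuit]
  · simp only [decide_eq_true hpos]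
    exact lineCircuit_cases (fun _ => trivial) (fun _ _ => trivial) (fun _ _ => trivial)
      fun _ _ _ _ _ _ => standardGadget_isMonotone

theorem Interpolates.monotoneBySelectorReplacement (hS : Interpolates S) :
    MonotoneBySelectorReplacement S := by
  refine ⟨fun t => lineCircuit 0 selGadget t.1 t.2,
    (Effective.primrec_lineCircuit Effective.primrec_selGadget 0).to_comp, Polynomial.X,
    fun F π hF hπ => ⟨lineCircuit_interpolates hS hF hπ (mono := false) nofun selGadget_computes,
      ?_, ?_, fun hpos => ?_⟩⟩
  · exact lineCircuit_cases (fun _ => trivial) (fun _ _ => trivial) (fun _ _ => trivial)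
      fun _ _ _ _ _ _ => trivial
  · simp [length_lineCircuit]
  · rw [replaceSel_lineCircuit_selGadget]
    exact ⟨lineCircuit_interpolates hS hF hπ (fun _ => hpos) orAndGadget_computes,
      lineCircuit_cases (fun _ => trivial) (fun _ _ => trivial) (fun _ _ => trivial)
        fun _ _ _ _ _ _ => trivial⟩

end Extraction

end QBFInterpolation

/-- Monotone feasible interpolation, and its realization by replacing selector gates, first for
LQU⁺-Res and IRM-calc, then for the other QBF resolution systems. -/
theorem theorem3p5 :
    (QBFInterpolation.HasMonotoneFeasibleInterpolation QBFInterpolation.lquPlusRes ∧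
      QBFInterpolation.MonotoneBySelectorReplacement QBFInterpolation.lquPlusRes) ∧
    (QBFInterpolation.HasMonotoneFeasibleInterpolation QBFInterpolation.irmCalc ∧
      QBFInterpolation.MonotoneBySelectorReplacement QBFInterpolation.irmCalc) ∧
    (∀ S ∈ ({QBFInterpolation.treeQRes, QBFInterpolation.qRes, QBFInterpolation.ldQRes,
        QBFInterpolation.quRes} : Set (QBFInterpolation.Calculus QBFInterpolation.MLit)),
      QBFInterpolation.HasMonotoneFeasibleInterpolation S ∧
        QBFInterpolation.MonotoneBySelectorReplacement S) ∧
    (∀ S ∈ ({QBFInterpolation.forallExpRes, QBFInterpolation.irCalc} :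
        Set (QBFInterpolation.Calculus QBFInterpolation.ALit)),
      QBFInterpolation.HasMonotoneFeasibleInterpolation S ∧
        QBFInterpolation.MonotoneBySelectorReplacement S) := by
  have extract {Λ : Type} [Primcodable Λ] {S : QBFInterpolation.Calculus Λ}
      (hS : QBFInterpolation.Interpolates S) :
      QBFInterpolation.HasMonotoneFeasibleInterpolation S ∧
        QBFInterpolation.MonotoneBySelectorReplacement S :=
    ⟨hS.hasMonotoneFeasibleInterpolation, hS.monotoneBySelectorReplacement⟩
  refine ⟨extract QBFInterpolation.interpolates_lquPlusRes,
    extract QBFInterpolation.interpolates_irmCalc, ?_, ?_⟩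
  · rintro S (rfl | rfl | rfl | rfl)
    · exact extract QBFInterpolation.interpolates_treeQRes
    · exact extract QBFInterpolation.interpolates_qRes
    · exact extract QBFInterpolation.interpolates_ldQRes
    · exact extract QBFInterpolation.interpolates_quRes
  · rintro S (rfl | rfl)
    · exact extract QBFInterpolation.interpolates_forallExpRes
    · exact extract QBFInterpolation.interpolates_irCalc
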